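/- For $q\in(0,1)$, $u\in\mathbb C$, $n\in\mathbb N_0$ put $(u;q)_n=\prod_{j=0}^{n-1}(1-uq^j)$, $(u;q)_\infty=\prod_{j=0}^{\infty}(1-uq^j)$, $(u_1,\dots,u_r;q)_n=\prod_{i}(u_i;q)_n$ (for $n\in\mathbb N_0\cup\{\infty\}$), and $$ {}_r\phi_s\!\left({u_1,\dots,u_r\atop v_1,\dots,v_s};q,z\right)=\sum_{k=0}^\infty\frac{(u_1,\dots,u_r;q)_k}{(q,v_1,\dots,v_s;q)_k}\left((-1)^kq^{\binom k2}\right)^{1+s-r}z^k . $$ For $x=\cos\theta\in[-1,1]$, $\theta\in[0,\pi]$, the Askey–Wilson polynomials (with $\alpha\neq0$) and their weight are $$ p_n(x;\alpha,b,c,d|q)=\alpha^{-n}(\alpha b,\alpha c,\alpha d;q)_n\;{}_4\phi_3\!\left({q^{-n},\alpha bcdq^{n-1},\alpha e^{i\theta},\alpha e^{-i\theta}\atop \alpha b,\alpha c,\alpha d};q,q\right), $$ $$ w(x;\alpha,b,c,d|q)=\left|\frac{(e^{2i\theta};q)_\infty}{(\alpha e^{i\theta},be^{i\theta},ce^{i\theta},de^{i\theta};q)_\infty}\right|^2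 . $$ **Corollary.** Let $n\in\mathbb N_0$, $q\in(0,1)$, let $\alpha,a,b,c,d,t\in\mathbb C$ with $\max(|\alpha|,|a|,|b|,|c|,|d|)<1$ and $|t|<(1-q)^3$, and suppose that $\alpha,b,c,d$ are real or, if not real, occur in complex conjugate pairs (that is, the multiset $\{\alpha,b,c,d\}$ is invariant under complex conjugation). Assume $\alpha\ne0$ and $abcd\neq q$. Then the integrand below is integrable on $[-1,1]$ and $$ \int_{-1}^1{}_2\phi_1\!\left({ae^{i\theta},be^{i\theta}\atop ab};q,te^{-i\theta}\right) {}_2\phi_1\!\left({ce^{-i\theta},de^{-i\theta}\atop cd};q,te^{i\theta}\right) p_n(x;\alpha,b,c,d|q)\,\frac{w(x;\alpha,b,c,d|q)}{\sqrt{1-x^2}}\,dx $$ $$ =\frac{2\pi t^n(\alpha bcdq^{2n};q)_\infty\, (\sqrt{abcd/q},-\sqrt{abcd/q},\sqrt{abcd},-\sqrt{abcd};q)_n} {(q^{n+1},\alpha bq^n,\alpha cq^n,\alpha dq^n,bcq^n,bdq^n,cdq^n;q)_\infty\, (q,ab,cd,abcd/q;q)_n}\; {}_4\phi_3\!\left({a/\alpha,bcq^n,bdq^n,abcdq^{2n-1}\atop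 abq^n,abcdq^{n-1},\alpha bcdq^{2n}};q,\alpha t\right), $$ where $\sqrt{\cdot}$ is the principal complex square root (the value does not depend on the choice of the root). -/

import Mathlib

noncomputable section

/-- The `q`-Pochhammer symbol `(a;q)_n = (1-a)(1-aq)⋯(1-aq^{n-1})`. -/
def qPoch (a q : ℂ) (n : ℕ) : ℂ := ∏ j ∈ Finset.range n, (1 - a * q ^ j)

/-- `(a;q)_∞ = ∏_{j ≥ 0} (1 - a q^j)`, used for `|q| < 1`. -/
def qPochInf (a q : ℂ) : ℂ := ∏' j : ℕ, (1 - a * q ^ j)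

/-- `(a₁,…,a_r;q)_n = (a₁;q)_n ⋯ (a_r;q)_n`. -/
def qPochs (as : List ℂ) (q : ℂ) (n : ℕ) : ℂ := (as.map fun a => qPoch a q n).prod

/-- `(a₁,…,a_r;q)_∞ = (a₁;q)_∞ ⋯ (a_r;q)_∞`. -/
def qPochsInf (as : List ℂ) (q : ℂ) : ℂ := (as.map fun a => qPochInf a q).prod

/-- The basic hypergeometric series `_rφ_s(a₁,…,a_r; b₁,…,b_s; q, z)`, where `r` and `s` are
the lengths of the two lists. -/
def basicHyp (as bs : List ℂ) (q z : ℂ) : ℂ :=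
  ∑' k : ℕ, qPochs as q k / qPochs (q :: bs) q k *
    ((-1) ^ k * q ^ (k.choose 2)) ^ (1 + (bs.length : ℤ) - (as.length : ℤ)) * z ^ k

/-- `e^{iθ}` for `x = cos θ` with `θ = arccos x ∈ [0, π]`. -/
def expITheta (x : ℝ) : ℂ := Complex.exp (Complex.I * (Real.arccos x : ℂ))

/-- The Askey–Wilson polynomial `p_n(x;a,b,c,d|q)` for `x ∈ [-1,1]` (and `a ≠ 0`). -/
def askeyWilson (n : ℕ) (x : ℝ) (a b c d q : ℂ) : ℂ :=
  a ^ (-(n : ℤ)) * qPochs [a * b, a * c, a * d] q n *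
    basicHyp
      [q ^ (-(n : ℤ)), a * b * c * d * q ^ ((n : ℤ) - 1), a * expITheta x, a * (expITheta x)⁻¹]
      [a * b, a * c, a * d] q q

/-- The Askey–Wilson weight
`w(x;a,b,c,d|q) = |(e^{2iθ};q)_∞ / (ae^{iθ},be^{iθ},ce^{iθ},de^{iθ};q)_∞|²`. -/
def askeyWilsonWeight (x : ℝ) (a b c d q : ℂ) : ℝ :=
  ‖qPochInf (expITheta x ^ 2) q /
    qPochsInf [a * expITheta x, b * expITheta x, c * expITheta x, d * expITheta x] q‖ ^ 2

/-- The four parameters are real or, if not real, occur in complex conjugate pairs (counted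
with multiplicity): the multiset `{a, b, c, d}` is invariant under complex conjugation. -/
def RealOrConjPairs (a b c d : ℂ) : Prop :=
  Multiset.map (starRingEnd ℂ) {a, b, c, d} = ({a, b, c, d} : Multiset ℂ)

/-- The integrand: the product of the two `₂φ₁` generating functions, times
`p_n(x;α,b,c,d|q) w(x;α,b,c,d|q) / √(1-x²)`. -/
def askeyWilsonIntegrand (n : ℕ) (α a b c d t q : ℂ) (x : ℝ) : ℂ :=
  basicHyp [a * expITheta x, b * expITheta x] [a * b] q (t * (expITheta x)⁻¹) *
    basicHyp [c * (expITheta x)⁻¹, d * (expITheta x)⁻¹] [c * d] q (t * expITheta x) *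
    askeyWilson n x α b c d q *
    ((askeyWilsonWeight x α b c d q / Real.sqrt (1 - x ^ 2) : ℝ) : ℂ)

end

open Finset Filter Topology MeasureTheory

/-! Put z = e^{iθ}. The product of the two ₂φ₁ series is a power series in t whose coefficient of
t^m is `awGenCoeff`. Two applications of the q-Saalschütz sum (`qSaalschutz`) with an interchange of
summation, i.e. Sears' transformation, identify this coefficient with a multiple of
p_m(x;a,b,c,d|q): `awGenCoeff_eq_awSum`. The integral thus becomes a series in t of pairings of
p_m(x;a,b,c,d|q) with p_n(x;α,b,c,d|q), two families sharing b, c, d, under the weight with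
parameters α, b, c, d.

For such a pairing, p_m is expanded in (bz,b/z;q)_k and p_n in (αz,α/z;q)_j. Multiplying the weight
by these factors only replaces α, b by αq^j, bq^k, so every term is an Askey–Wilson integral
(`awMass_eq`). The sum over j is Saalschützian and produces (q^{k+1-n};q)_n, which vanishes for k <
n; hence only m = n + r with r ≥ 0 contributes. The sum over k is Saalschützian again and produces
(a/α;q)_r. Summed over r, these values form the ₄φ₃ on the right-hand side.

The Askey–Wilson integral comes from a contour shift: a combination of the kernels for aq and a is a
q-difference g(qz) - g(z) with g holomorphic on q ≤ |z| ≤ 1 (`awMass_mul_left`). Iterating sends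
each parameter to 0, and the remaining constant is read off from one elementary case
(`awMass_zero`).

Sears' transformation divides by b, c, d; zero values are recovered by continuity
(`eq_of_continuousOn_of_ne_zero`). Geometric bounds in t justify termwise integration. -/

/-! ### Finite q-Pochhammer symbols and the q-Pfaff–Saalschütz sum. -/

lemma qPoch_zero (a q : ℂ) : qPoch a q 0 = 1 := by simp [qPoch]

lemma qPoch_succ (a q : ℂ) (n : ℕ) : qPoch a q (n + 1) = qPoch a q n * (1 - a * q ^ n) := by
  simp [qPoch, Finset.prod_range_succ]

lemma qPoch_succ' (a q : ℂ) (n : ℕ) :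
    qPoch a q (n + 1) = (1 - a) * qPoch (a * q) q n := by
  simp only [qPoch, Finset.prod_range_succ', pow_zero, mul_one]
  rw [mul_comm]
  congr 1
  refine Finset.prod_congr rfl fun j _ => ?_
  ring

lemma qPoch_add (a q : ℂ) (m n : ℕ) :
    qPoch a q (m + n) = qPoch a q m * qPoch (a * q ^ m) q n := by
  simp only [qPoch, Finset.prod_range_add]
  congr 1
  refine Finset.prod_congr rfl fun j _ => ?_
  ring

lemma one_sub_mul_pow_ne_zero {a q : ℂ} (hq : ‖q‖ ≤ 1) (ha : ‖a‖ < 1) (j : ℕ) :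
    1 - a * q ^ j ≠ 0 := by
  intro h
  have h1 : ‖a * q ^ j‖ = 1 := by rw [← sub_eq_zero.mp h]; simp
  rw [norm_mul, norm_pow] at h1
  have h2 : ‖q‖ ^ j ≤ 1 := pow_le_one₀ (norm_nonneg _) hq
  nlinarith [norm_nonneg a, pow_nonneg (norm_nonneg q) j]

lemma qPoch_ne_zero {a q : ℂ} (hq : ‖q‖ ≤ 1) (ha : ‖a‖ < 1) (n : ℕ) : qPoch a q n ≠ 0 :=
  Finset.prod_ne_zero_iff.mpr fun j _ => one_sub_mul_pow_ne_zero hq ha j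

/-- Reversal of a `q`-Pochhammer symbol: `(y;q)_n = (-y)^n q^{n(n-1)/2} (x;q)_n` when
`x y q^{n-1} = 1`. -/
lemma qPoch_reverse {q x y : ℂ} {n : ℕ} (hq : q ≠ 0) (h : y * x * q ^ n = q) :
    qPoch y q n = (-y) ^ n * q ^ n.choose 2 * qPoch x q n := by
  induction n generalizing x with
  | zero => simp [qPoch]
  | succ n ih =>
    have h' : y * (x * q) * q ^ n = q := by linear_combination h
    have h1 : y * q ^ n * x = 1 := by
      apply mul_right_cancel₀ hq; linear_combination h
    rw [qPoch_succ, ih h', qPoch_succ' x, Nat.choose_succ_succ' n 1, Nat.choose_one_right]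
    have : 1 - y * q ^ n = - y * q ^ n * (1 - x) := by linear_combination (-1 : ℂ) * h1
    rw [this]; ring

/-- The `q`-Pfaff–Saalschütz sum in polynomial form. -/
theorem qSaalschutz {q : ℂ} (hq : ‖q‖ < 1) (A B e : ℂ) (n : ℕ) :
    ∑ p ∈ antidiagonal n, qPoch A q p.1 * qPoch B q p.1 * qPoch e q p.2 *
        qPoch (A * B * e * q ^ p.1) q p.2 * e ^ p.1 / (qPoch q q p.1 * qPoch q q p.2) =
      qPoch (A * e) q n * qPoch (B * e) q n / qPoch q q n := by
  set T : ℕ → ℕ → ℂ := fun k l => qPoch A q k * qPoch B q k * qPoch e q l *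
        qPoch (A * B * e * q ^ k) q l * e ^ k / (qPoch q q k * qPoch q q l) with hT
  have hne : ∀ n, qPoch q q n ≠ 0 := qPoch_ne_zero hq.le hq
  have hne1 : ∀ n : ℕ, 1 - q * q ^ n ≠ 0 := one_sub_mul_pow_ne_zero hq.le hq
  induction n with
  | zero => simp [qPoch]
  | succ n ih =>
    change ∑ p ∈ antidiagonal n, T p.1 p.2 = _ at ih
    change ∑ p ∈ antidiagonal (n + 1), T p.1 p.2 = _
    -- A Pascal-type recurrence: the summand at (k, l) is a combination of those at (k - 1, l) and
    -- (k, l - 1), with a missing neighbour counted as 0. Summation over k + l = n + 1 then reduces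
    -- to the sum over k + l = n.
    have hU : ∀ k l, (1 - q ^ (k + l)) * T k l =
        (match k with
          | 0 => 0
          | k + 1 => q ^ l * e * (1 - A * q ^ k) * (1 - B * q ^ k) * T k l) +
        (match l with
          | 0 => 0
          | l + 1 => (1 - e * q ^ l) * (1 - A * B * e * q ^ (k + l + k)) * T k l) := by
      rintro (_ | k) (_ | l)
      · simp
      · have h1 := hne l
        have h2 := hne1 l
        simp only [hT, qPoch_zero, qPoch_succ _ _ l, zero_add, add_zero, pow_zero, pow_succ']
        generalize q ^ l = w at *
        field_simp
      · have h1 := hne k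
        have h2 := hne1 k
        simp only [hT, qPoch_zero, qPoch_succ _ _ k, add_zero, pow_zero, pow_succ']
        generalize q ^ k = w at *
        field_simp
      · have h1 := hne k
        have h2 := hne1 k
        have h3 := hne l
        have h4 := hne1 l
        have h5 : qPoch (A * B * e * q ^ k) q (l + 1) =
            (1 - A * B * e * q ^ k) * qPoch (A * B * e * q ^ (k + 1)) q l := by
          rw [qPoch_succ']; ring_nf
        have h6 : qPoch (A * B * e * q ^ (k + 1)) q (l + 1) =
            qPoch (A * B * e * q ^ (k + 1)) q l * (1 - A * B * e * q ^ (k + 1 + l)) := by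
          rw [qPoch_succ]; ring_nf
        simp only [hT, h5, h6, qPoch_succ A, qPoch_succ B, qPoch_succ e, qPoch_succ q]
        simp only [pow_add, pow_one]
        generalize qPoch (A * B * e * (q ^ k * q)) q l = Y
        clear h5 h6 ih
        generalize q ^ k = v at *
        generalize q ^ l = w at *
        have h2' : 1 - v * q ≠ 0 := by rwa [mul_comm]
        have h4' : 1 - w * q ≠ 0 := by rwa [mul_comm]
        field_simp
        ring
    apply mul_left_cancel₀ (hne1 n)
    rw [← pow_succ']
    rw [mul_sum, sum_congr rfl fun p hp => by rw [← mem_antidiagonal.mp hp, hU],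
      sum_add_distrib, Nat.sum_antidiagonal_succ, Nat.sum_antidiagonal_succ', ← add_assoc]
    simp only [zero_add, add_zero]
    rw [← sum_add_distrib]
    -- The two coefficients leaving (k, l) add up to a quantity depending only on k + l = n, which
    -- is the growth factor of the closed form.
    have hstep : ∀ p ∈ antidiagonal n, q ^ p.2 * e * (1 - A * q ^ p.1) * (1 - B * q ^ p.1) *
          T p.1 p.2 + (1 - e * q ^ p.2) * (1 - A * B * e * q ^ (p.1 + p.2 + p.1)) * T p.1 p.2 =
        (1 - A * e * q ^ n) * (1 - B * e * q ^ n) * T p.1 p.2 := fun p hp => by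
      rw [← mem_antidiagonal.mp hp]; ring
    rw [sum_congr rfl hstep, ← mul_sum, ih, qPoch_succ, qPoch_succ, qPoch_succ q, ← pow_succ']
    have h1 := hne n
    have h2 := hne1 n
    rw [← pow_succ'] at h2
    field_simp

/-- The `q`-Pfaff–Saalschütz sum, with the denominators moved to the numerator. -/
theorem qSaalschutz_reverse {q : ℂ} (hq : ‖q‖ < 1) (hq0 : q ≠ 0) (A B C G : ℂ) (r : ℕ)
    (hC : C ≠ 0) (h : A * B * q = C * G * q ^ r) :
    ∑ p ∈ antidiagonal r, (-1) ^ p.1 * q ^ p.2.choose 2 * qPoch A q p.1 * qPoch B q p.1 *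
        qPoch (C * q ^ p.1) q p.2 * qPoch (G * q ^ p.1) q p.2 / (qPoch q q p.1 * qPoch q q p.2) =
      (-(C * q ^ r / q)) ^ r * qPoch (A * (q / (C * q ^ r))) q r *
        qPoch (B * (q / (C * q ^ r))) q r / qPoch q q r := by
  -- This e makes (e;q)_i the reversal of (Cq^j;q)_i whenever i + j = r; the balancing condition
  -- then reads G = ABe.
  set e := q / (C * q ^ r) with he
  have he0 : e ≠ 0 := by positivity
  have hG : G = A * B * e := by rw [he]; field_simp; linear_combination -h
  have hCe : C * q ^ r / q = e⁻¹ := by rw [he]; field_simp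
  rw [mul_assoc, mul_div_assoc, ← qSaalschutz hq A B e r, mul_sum, hCe]
  refine sum_congr rfl fun p hp => ?_
  have hp' := mem_antidiagonal.mp hp
  have hrev : qPoch e q p.2 = (-e) ^ p.2 * q ^ p.2.choose 2 * qPoch (C * q ^ p.1) q p.2 := by
    apply qPoch_reverse hq0
    rw [he, ← hp']
    field_simp
    ring
  rw [hrev, hG, ← hp', pow_add]
  have h1 := qPoch_ne_zero hq.le hq p.1
  have h2 := qPoch_ne_zero hq.le hq p.2
  have h3 : (-e⁻¹) ^ p.1 * e ^ p.1 = (-1) ^ p.1 := by rw [← mul_pow]; field_simp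
  have h4 : (-e⁻¹) ^ p.2 * (-e) ^ p.2 = 1 := by rw [← mul_pow]; field_simp; simp
  rw [← h3]
  linear_combination (-(-e⁻¹) ^ p.1 * e ^ p.1 * q ^ p.2.choose 2 * qPoch A q p.1 * qPoch B q p.1 *
    qPoch (C * q ^ p.1) q p.2 * qPoch (A * B * e * q ^ p.1) q p.2 /
      (qPoch q q p.1 * qPoch q q p.2)) * h4

/-! ### Sears' transformation and the generating coefficients. -/

lemma sum_antidiagonal_assoc {M : Type*} [AddCommMonoid M] (f : ℕ → ℕ → ℕ → M) (n : ℕ) :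
    ∑ p ∈ antidiagonal n, ∑ r ∈ antidiagonal p.1, f r.1 r.2 p.2 =
      ∑ p ∈ antidiagonal n, ∑ r ∈ antidiagonal p.2, f p.1 r.1 r.2 := by
  rw [sum_sigma', sum_sigma']
  refine sum_bij' (fun x _ => ⟨(x.2.1, x.2.2 + x.1.2), (x.2.2, x.1.2)⟩)
    (fun x _ => ⟨(x.1.1 + x.2.1, x.2.2), (x.1.1, x.2.1)⟩) ?_ ?_ ?_ ?_ ?_
  · rintro ⟨⟨a, b⟩, ⟨c, d⟩⟩ h
    simp only [mem_sigma, HasAntidiagonal.mem_antidiagonal, and_true] at h ⊢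
    omega
  · rintro ⟨⟨a, b⟩, ⟨c, d⟩⟩ h
    simp only [mem_sigma, HasAntidiagonal.mem_antidiagonal, and_true] at h ⊢
    omega
  · rintro ⟨⟨a, b⟩, ⟨c, d⟩⟩ h
    simp only [mem_sigma, HasAntidiagonal.mem_antidiagonal] at h ⊢
    simp [h.2]
  · rintro ⟨⟨a, b⟩, ⟨c, d⟩⟩ h
    simp only [mem_sigma, HasAntidiagonal.mem_antidiagonal] at h ⊢
    simp [h.2]
  · simp

lemma pow_choose_two_add (q : ℂ) (k l : ℕ) :
    q ^ (k + l).choose 2 = q ^ k.choose 2 * q ^ l.choose 2 * q ^ (k * l) := by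
  rw [← pow_add, ← pow_add]
  congr 1
  induction l with
  | zero => simp
  | succ l ih =>
    rw [← add_assoc, Nat.choose_succ_succ' _ 1, Nat.choose_succ_succ' l 1, ih]
    simp only [Nat.choose_one_right]
    ring

lemma pow_choose_two_sq (q : ℂ) (k : ℕ) : q ^ k.choose 2 * q ^ k.choose 2 * q ^ k = q ^ (k * k) := by
  rw [← pow_add, ← pow_add]
  congr 1
  induction k with
  | zero => simp
  | succ k ih =>
    rw [Nat.choose_succ_succ' _ 1]
    simp only [Nat.choose_one_right]
    linarith

/-- The coefficient of `t^m` in the product of the two `₂φ₁` series in the generating function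
of the Askey–Wilson polynomials. -/
noncomputable def awGenCoeff (a b c d q : ℂ) (m : ℕ) (z : ℂ) : ℂ :=
  ∑ p ∈ antidiagonal m,
    qPoch (a * z) q p.1 * qPoch (b * z) q p.1 / (qPoch q q p.1 * qPoch (a * b) q p.1) * z⁻¹ ^ p.1 *
      (qPoch (c * z⁻¹) q p.2 * qPoch (d * z⁻¹) q p.2 / (qPoch q q p.2 * qPoch (c * d) q p.2) *
        z ^ p.2)

/-- The Askey–Wilson polynomial in the variable `z = e^{iθ}`, up to normalisation. -/
noncomputable def awSum (a b c d q : ℂ) (n : ℕ) (z : ℂ) : ℂ :=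
  ∑ p ∈ antidiagonal n, (-1) ^ p.1 * q ^ p.2.choose 2 * qPoch (a * b * c * d * q ^ n / q) q p.1 *
    (qPoch (a * z) q p.1 * qPoch (a * z⁻¹) q p.1) *
    (qPoch (a * b * q ^ p.1) q p.2 * qPoch (a * c * q ^ p.1) q p.2 *
      qPoch (a * d * q ^ p.1) q p.2) / (qPoch q q p.1 * qPoch q q p.2)

/-- Collects all signs and powers created by the reversals in the first half of Sears'
transformation; they collapse to z^{l-k}. -/
lemma sears_scalar_identity {c d q z : ℂ} {k l m : ℕ} (hq0 : q ≠ 0) (hc : c ≠ 0) (hd : d ≠ 0)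
    (hz : z ≠ 0) (hkl : k + l = m) :
    (-d) ^ m * q ^ m.choose 2 * (-(z * q / (d * q ^ l))) ^ l * q ^ l.choose 2 *
      (c * z⁻¹) ^ k * (-(q / (c * d * q ^ m))) ^ k * q ^ k.choose 2 = z⁻¹ ^ k * z ^ l := by
  have h1 := pow_choose_two_sq q k
  have h2 := pow_choose_two_sq q l
  rw [← hkl, pow_choose_two_add]
  simp only [neg_pow (_ / _), div_pow, mul_pow, ← pow_mul, pow_add, ← h1, ← h2,
      neg_pow d, inv_pow, mul_comm l k]
  have h3 : ((-1 : ℂ) ^ k) ^ 2 = 1 := by rw [← pow_mul, mul_comm, pow_mul]; simp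
  have h4 : ((-1 : ℂ) ^ l) ^ 2 = 1 := by rw [← pow_mul, mul_comm, pow_mul]; simp
  generalize (-1 : ℂ) ^ k = u at *
  generalize (-1 : ℂ) ^ l = v at *
  field_simp
  rw [h3, h4]
  ring

/-- The generating function of the Askey–Wilson polynomials, coefficientwise. This is an instance
of Sears' transformation of terminating balanced `₄φ₃` series. -/
theorem awGenCoeff_eq_awSum {a b c d q z : ℂ} (hq : ‖q‖ < 1) (hq0 : q ≠ 0) (hb : b ≠ 0)
    (hc : c ≠ 0) (hd : d ≠ 0) (hz : z ≠ 0) (hab : ‖a * b‖ < 1) (hcd : ‖c * d‖ < 1) (m : ℕ) :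
    qPoch (a * b) q m * qPoch (c * d) q m * awGenCoeff a b c d q m z =
      (b ^ m * q ^ m.choose 2)⁻¹ * awSum b a c d q m z := by
  have hne : ∀ n, qPoch q q n ≠ 0 := qPoch_ne_zero hq.le hq
  have habne : ∀ n, qPoch (a * b) q n ≠ 0 := qPoch_ne_zero hq.le hab
  have hcdne : ∀ n, qPoch (c * d) q n ≠ 0 := qPoch_ne_zero hq.le hcd
  set X := b * a * c * d * q ^ m / q with hX
  -- Chosen so that Xe = az and (b/z)Xe = ab: Saalschütz with A = b/z, B = X then expands (az;q)_k /
  -- (ab;q)_k.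
  set e := z * q / (b * c * d * q ^ m) with he
  -- The other product in this use of Saalschütz, (be/z;q)_k, reverses to (cdq^l;q)_k, which is
  -- exactly (cd;q)_m / (cd;q)_l.
  have step1 : ∀ p ∈ antidiagonal m, qPoch (c * d) q m *
      (qPoch (a * z) q p.1 * qPoch (b * z) q p.1 / (qPoch q q p.1 * qPoch (a * b) q p.1) *
        z⁻¹ ^ p.1 *
      (qPoch (c * z⁻¹) q p.2 * qPoch (d * z⁻¹) q p.2 / (qPoch q q p.2 * qPoch (c * d) q p.2) *
        z ^ p.2)) = ∑ r ∈ antidiagonal p.1, (-d) ^ m * q ^ m.choose 2 * qPoch (b * z) q (r.1 + r.2) *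
          qPoch (c * z⁻¹) q p.2 * qPoch (z * q / (d * q ^ p.2)) q p.2 * (c * z⁻¹) ^ (r.1 + r.2) /
          qPoch q q p.2 * (qPoch (b * z⁻¹) q r.1 * qPoch X q r.1 * qPoch e q r.2 * e ^ r.1 /
            (qPoch (a * b) q r.1 * qPoch q q r.1 * qPoch q q r.2)) := by
    rintro ⟨k, l⟩ hp
    have hkl : k + l = m := HasAntidiagonal.mem_antidiagonal.mp hp
    dsimp only
    have hs := qSaalschutz hq (b * z⁻¹) X e k
    have e1 : b * z⁻¹ * X * e = a * b := by rw [hX, he]; field_simp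
    have e2 : b * z⁻¹ * e = q / (c * d * q ^ m) := by rw [he]; field_simp
    have e3 : X * e = a * z := by rw [hX, he]; field_simp
    rw [e1, e2, e3, qPoch_reverse (x := c * d * q ^ l) hq0
      (by rw [← hkl]; field_simp; ring)] at hs
    rw [qPoch_reverse (y := z * q / (d * q ^ l)) (x := d * z⁻¹) hq0 (by field_simp)]
    have hcdm : qPoch (c * d) q m = qPoch (c * d) q l * qPoch (c * d * q ^ l) q k := by
      rw [← qPoch_add, add_comm, hkl]
    have hscal := sears_scalar_identity hq0 hc hd hz hkl
    have hsum : ∀ r ∈ antidiagonal k, (-d) ^ m * q ^ m.choose 2 * qPoch (b * z) q (r.1 + r.2) *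
          qPoch (c * z⁻¹) q l * ((-(z * q / (d * q ^ l))) ^ l * q ^ l.choose 2 *
            qPoch (d * z⁻¹) q l) * (c * z⁻¹) ^ (r.1 + r.2) /
          qPoch q q l * (qPoch (b * z⁻¹) q r.1 * qPoch X q r.1 * qPoch e q r.2 * e ^ r.1 /
            (qPoch (a * b) q r.1 * qPoch q q r.1 * qPoch q q r.2)) =
        (-d) ^ m * q ^ m.choose 2 * qPoch (b * z) q k *
          qPoch (c * z⁻¹) q l * ((-(z * q / (d * q ^ l))) ^ l * q ^ l.choose 2 *
            qPoch (d * z⁻¹) q l) * (c * z⁻¹) ^ k / qPoch q q l / qPoch (a * b) q k *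
        (qPoch (b * z⁻¹) q r.1 * qPoch X q r.1 * qPoch e q r.2 *
        qPoch (a * b * q ^ r.1) q r.2 * e ^ r.1 / (qPoch q q r.1 * qPoch q q r.2)) := by
      intro r hr
      have hr' := HasAntidiagonal.mem_antidiagonal.mp hr
      have h1 : qPoch (a * b) q k = qPoch (a * b) q r.1 * qPoch (a * b * q ^ r.1) q r.2 := by
        rw [← qPoch_add, hr']
      have h2 : (qPoch (a * b) q r.1)⁻¹ =
          (qPoch (a * b) q k)⁻¹ * qPoch (a * b * q ^ r.1) q r.2 := by
        have h2 := habne k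
        rw [h1] at h2
        rw [h1, mul_inv, mul_assoc, inv_mul_cancel₀ (right_ne_zero_of_mul h2), mul_one]
      rw [hr']
      simp only [div_eq_mul_inv, mul_inv, h2]
      generalize (-(z * q * (d⁻¹ * (q ^ l)⁻¹))) ^ l = W
      ring
    rw [sum_congr rfl hsum, ← mul_sum, hs, hcdm]
    have h1 := hne k
    have h2 := hne l
    have h3 := habne k
    have h4 := hcdne l
    have h5 : qPoch (c * d) q l * (qPoch (a * z) q k * qPoch (b * z) q k / (qPoch q q k *
        qPoch (a * b) q k) * z⁻¹ ^ k * (qPoch (c * z⁻¹) q l * qPoch (d * z⁻¹) q l /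
        (qPoch q q l * qPoch (c * d) q l) * z ^ l)) = (qPoch (a * z) q k * qPoch (b * z) q k /
        (qPoch q q k * qPoch (a * b) q k) * (qPoch (c * z⁻¹) q l * qPoch (d * z⁻¹) q l /
        qPoch q q l)) * (z⁻¹ ^ k * z ^ l) := by
      field_simp
    rw [mul_right_comm, h5, ← hscal]
    ring
  -- After the interchange, with j fixed, the sum over the other two indices is Saalschützian with
  -- parameters bzq^j, e, c/z. It yields (bcq^j;q)_s and, after reversal, (bdq^j;q)_s, where s = m -
  -- j.
  have step2 : ∀ p ∈ antidiagonal m, ∑ r ∈ antidiagonal p.2,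
        (-d) ^ m * q ^ m.choose 2 * qPoch (b * z) q (p.1 + r.1) *
          qPoch (c * z⁻¹) q r.2 * qPoch (z * q / (d * q ^ r.2)) q r.2 * (c * z⁻¹) ^ (p.1 + r.1) /
          qPoch q q r.2 * (qPoch (b * z⁻¹) q p.1 * qPoch X q p.1 * qPoch e q r.1 * e ^ p.1 /
            (qPoch (a * b) q p.1 * qPoch q q p.1 * qPoch q q r.1)) =
      (b ^ m * q ^ m.choose 2)⁻¹ * ((-1) ^ p.1 * q ^ p.2.choose 2 * qPoch X q p.1 *
        (qPoch (b * z) q p.1 * qPoch (b * z⁻¹) q p.1) * (qPoch (b * c * q ^ p.1) q p.2 *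
        qPoch (b * d * q ^ p.1) q p.2) / (qPoch (a * b) q p.1 * qPoch q q p.1 * qPoch q q p.2)) := by
    rintro ⟨j, s⟩ hp
    have hjs : j + s = m := HasAntidiagonal.mem_antidiagonal.mp hp
    dsimp only
    have hs := qSaalschutz hq (b * z * q ^ j) e (c * z⁻¹) s
    have e2 : b * z * q ^ j * (c * z⁻¹) = b * c * q ^ j := by field_simp
    have e3 : e * (c * z⁻¹) = q / (b * d * q ^ m) := by rw [he]; field_simp
    rw [e2, e3, qPoch_reverse (y := q / (b * d * q ^ m)) (x := b * d * q ^ j) hq0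
      (by rw [← hjs]; field_simp; ring)] at hs
    have hsum : ∀ r ∈ antidiagonal s, (-d) ^ m * q ^ m.choose 2 * qPoch (b * z) q (j + r.1) *
          qPoch (c * z⁻¹) q r.2 * qPoch (z * q / (d * q ^ r.2)) q r.2 * (c * z⁻¹) ^ (j + r.1) /
          qPoch q q r.2 * (qPoch (b * z⁻¹) q j * qPoch X q j * qPoch e q r.1 * e ^ j /
            (qPoch (a * b) q j * qPoch q q j * qPoch q q r.1)) =
        (-d) ^ m * q ^ m.choose 2 * qPoch (b * z) q j * (c * z⁻¹ * e) ^ j *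
          (qPoch (b * z⁻¹) q j * qPoch X q j / (qPoch (a * b) q j * qPoch q q j)) *
        (qPoch (b * z * q ^ j) q r.1 * qPoch e q r.1 * qPoch (c * z⁻¹) q r.2 *
          qPoch (b * z * q ^ j * e * (c * z⁻¹) * q ^ r.1) q r.2 * (c * z⁻¹) ^ r.1 /
          (qPoch q q r.1 * qPoch q q r.2)) := by
      intro r hr
      have hr' := HasAntidiagonal.mem_antidiagonal.mp hr
      have h1 : b * z * q ^ j * e * (c * z⁻¹) * q ^ r.1 = z * q / (d * q ^ r.2) := by
        rw [he, ← hjs, ← hr']; field_simp; ring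
      rw [h1, qPoch_add, pow_add, mul_pow _ e j]
      ring
    rw [sum_congr rfl hsum, ← mul_sum, hs]
    have hscal : (-d) ^ m * q ^ m.choose 2 * (c * z⁻¹ * e) ^ j * (-(q / (b * d * q ^ m))) ^ s *
        q ^ s.choose 2 = (b ^ m * q ^ m.choose 2)⁻¹ * ((-1) ^ j * q ^ s.choose 2) := by
      have h1 := pow_choose_two_sq q m
      have h2 : c * z⁻¹ * e = q / (b * d * q ^ m) := by rw [← e3]; ring
      have h3 : (q / (b * d * q ^ m)) ^ m = q ^ m / (b ^ m * d ^ m * q ^ (m * m)) := by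
        rw [div_pow, mul_pow, mul_pow, ← pow_mul]
      have h4 : (-1 : ℂ) ^ m * (-1) ^ s = (-1) ^ j := by
        rw [← hjs, pow_add, mul_assoc, ← pow_add, ← two_mul, pow_mul]; simp
      have h5 : (q / (b * d * q ^ m)) ^ j * (q / (b * d * q ^ m)) ^ s =
          q ^ m / (b ^ m * d ^ m * q ^ (m * m)) := by rw [← pow_add, hjs, h3]
      rw [h2, neg_pow (_ / _), neg_pow d, ← h4]
      have h6 : (-1 : ℂ) ^ m * d ^ m * q ^ m.choose 2 * (q / (b * d * q ^ m)) ^ j *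
          ((-1) ^ s * (q / (b * d * q ^ m)) ^ s) * q ^ s.choose 2 =
          (-1 : ℂ) ^ m * d ^ m * q ^ m.choose 2 * (-1) ^ s * q ^ s.choose 2 *
          ((q / (b * d * q ^ m)) ^ j * (q / (b * d * q ^ m)) ^ s) := by ring
      rw [h6, h5, ← h1]
      field_simp
    linear_combination (qPoch (b * z) q j * (qPoch (b * z⁻¹) q j * qPoch X q j /
      (qPoch (a * b) q j * qPoch q q j)) * (qPoch (b * c * q ^ j) q s *
      qPoch (b * d * q ^ j) q s / qPoch q q s)) * hscal
  rw [mul_assoc, awGenCoeff, mul_sum, sum_congr rfl step1, sum_antidiagonal_assoc (fun j i l =>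
    (-d) ^ m * q ^ m.choose 2 * qPoch (b * z) q (j + i) *
          qPoch (c * z⁻¹) q l * qPoch (z * q / (d * q ^ l)) q l * (c * z⁻¹) ^ (j + i) /
          qPoch q q l * (qPoch (b * z⁻¹) q j * qPoch X q j * qPoch e q i * e ^ j /
            (qPoch (a * b) q j * qPoch q q j * qPoch q q i))), sum_congr rfl step2, ← mul_sum,
    mul_left_comm, awSum, mul_sum]
  congr 1
  refine sum_congr rfl fun p hp => ?_
  have h1 : qPoch (a * b) q m = qPoch (a * b) q p.1 * qPoch (a * b * q ^ p.1) q p.2 := by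
    rw [← qPoch_add, HasAntidiagonal.mem_antidiagonal.mp hp]
  have h2 := habne p.1
  rw [h1, mul_comm b a, hX, mul_comm b a]
  field_simp

/-! ### Infinite q-products: convergence, holomorphy, bounds. -/

lemma summable_norm_mul_pow (a : ℂ) {q : ℂ} (hq : ‖q‖ < 1) :
    Summable fun j : ℕ => ‖-(a * q ^ j)‖ := by
  simp only [norm_neg, norm_mul, norm_pow]
  exact (summable_geometric_of_lt_one (norm_nonneg _) hq).mul_left _

lemma multipliable_one_sub_mul_pow (a : ℂ) {q : ℂ} (hq : ‖q‖ < 1) :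
    Multipliable fun j : ℕ => 1 - a * q ^ j := by
  simp_rw [sub_eq_add_neg]
  exact multipliable_one_add_of_summable (summable_norm_mul_pow a hq)

lemma tendsto_qPoch (a : ℂ) {q : ℂ} (hq : ‖q‖ < 1) :
    Tendsto (qPoch a q) atTop (𝓝 (qPochInf a q)) :=
  (multipliable_one_sub_mul_pow a hq).hasProd.tendsto_prod_nat

lemma qPochInf_eq_qPoch_mul (a : ℂ) {q : ℂ} (hq : ‖q‖ < 1) (n : ℕ) :
    qPochInf a q = qPoch a q n * qPochInf (a * q ^ n) q := by
  rw [qPochInf, ← Multipliable.prod_mul_tprod_nat_mul' (k := n)]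
  · simp only [qPochInf, qPoch]
    congr 2
    ext j
    ring
  · convert multipliable_one_sub_mul_pow (a * q ^ n) hq using 2 with j
    ring

lemma qPochInf_eq_mul (a : ℂ) {q : ℂ} (hq : ‖q‖ < 1) :
    qPochInf a q = (1 - a) * qPochInf (a * q) q := by
  simpa [qPoch] using qPochInf_eq_qPoch_mul a hq 1

lemma qPochInf_zero (q : ℂ) : qPochInf 0 q = 1 := by simp [qPochInf]

lemma qPochInf_ne_zero {a q : ℂ} (hq : ‖q‖ < 1) (ha : ‖a‖ < 1) : qPochInf a q ≠ 0 := by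
  simp only [qPochInf, sub_eq_add_neg]
  refine tprod_one_add_ne_zero_of_summable (fun j => ?_) (summable_norm_mul_pow a hq)
  rw [← sub_eq_add_neg]
  exact one_sub_mul_pow_ne_zero hq.le ha j

/-- The product converges locally uniformly, by comparison with a geometric series on each ball.
Holomorphy is what later permits moving the contour. -/
lemma differentiable_qPochInf {q : ℂ} (hq : ‖q‖ < 1) : Differentiable ℂ fun a => qPochInf a q := by
  intro a
  have h : HasProdLocallyUniformlyOn (fun (n : ℕ) (x : ℂ) => 1 + -(x * q ^ n))
      (fun x => ∏' n : ℕ, (1 + -(x * q ^ n))) (Metric.ball 0 (‖a‖ + 1)) := by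
    refine Summable.hasProdLocallyUniformlyOn_nat_one_add (u := fun n => (‖a‖ + 1) * ‖q‖ ^ n)
      Metric.isOpen_ball ((summable_geometric_of_lt_one (norm_nonneg _) hq).mul_left _)
      (.of_forall fun n x hx => ?_) fun n => by fun_prop
    rw [norm_neg, norm_mul, norm_pow]
    gcongr
    exact (mem_ball_zero_iff.mp hx).le
  have h2 : DifferentiableOn ℂ (fun x => qPochInf x q) (Metric.ball 0 (‖a‖ + 1)) := by
    simp only [qPochInf, sub_eq_add_neg]
    exact h.differentiableOn (.of_forall fun _ => by
      simpa [Finset.prod_fn] using DifferentiableOn.finsetProd (fun _ _ => by fun_prop))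
      Metric.isOpen_ball
  exact h2.differentiableAt (Metric.isOpen_ball.mem_nhds (by simp))

lemma continuous_qPochInf {q : ℂ} (hq : ‖q‖ < 1) : Continuous fun a => qPochInf a q :=
  (differentiable_qPochInf hq).continuous

lemma Continuous.qPochInf {X : Type*} [TopologicalSpace X] {q : ℂ} (hq : ‖q‖ < 1) {f : X → ℂ}
    (hf : Continuous f) : Continuous fun x => qPochInf (f x) q :=
  (continuous_qPochInf hq).comp hf

lemma Continuous.qPoch {X : Type*} [TopologicalSpace X] (q : ℂ) (n : ℕ) {f : X → ℂ}
    (hf : Continuous f) : Continuous fun x => qPoch (f x) q n := by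
  unfold _root_.qPoch
  fun_prop

lemma conj_qPochInf (a : ℂ) {q : ℝ} (hq : ‖(q : ℂ)‖ < 1) :
    starRingEnd ℂ (qPochInf a q) = qPochInf (starRingEnd ℂ a) q := by
  have h1 := (Complex.continuous_conj.tendsto _).comp (tendsto_qPoch a hq)
  refine tendsto_nhds_unique h1 ((tendsto_qPoch (starRingEnd ℂ a) hq).congr fun n => ?_)
  simp [qPoch]

/-- `(x²;q)_∞ = (x,-x,sx,-sx;q)_∞` for `s² = q`. -/
lemma qPochInf_sq {q s : ℂ} (hq : ‖q‖ < 1) (hs : s ^ 2 = q) (x : ℂ) :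
    qPochInf (x ^ 2) q =
      qPochInf x q * qPochInf (-x) q * qPochInf (s * x) q * qPochInf (-(s * x)) q := by
  -- Only partial products of even length factor: the factors 2j and 2j + 1 of the left side match
  -- the j-th factors of the four products on the right.
  have h1 : Tendsto (fun n => qPoch (x ^ 2) q (2 * n)) atTop (𝓝 (qPochInf (x ^ 2) q)) :=
    (tendsto_qPoch _ hq).comp (tendsto_id.const_mul_atTop' two_pos)
  refine tendsto_nhds_unique h1 (((((tendsto_qPoch x hq).mul (tendsto_qPoch (-x) hq)).mul
    (tendsto_qPoch (s * x) hq)).mul (tendsto_qPoch (-(s * x)) hq)).congr fun n => ?_)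
  induction n with
  | zero => simp [qPoch]
  | succ n ih =>
    rw [show 2 * (n + 1) = 2 * n + 1 + 1 from rfl, qPoch_succ _ _ (2 * n + 1), qPoch_succ _ _ (2 * n), ← ih]
    simp only [qPoch_succ _ _ n, ← hs]
    ring

lemma exists_norm_qPoch_le {q : ℂ} (hq : ‖q‖ < 1) :
    ∃ C : ℝ, 0 ≤ C ∧ ∀ a : ℂ, ‖a‖ ≤ 1 → ∀ n, ‖qPoch a q n‖ ≤ C := by
  refine ⟨Real.exp (∑' j : ℕ, ‖q‖ ^ j), (Real.exp_pos _).le, fun a ha n => ?_⟩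
  rw [qPoch, norm_prod]
  calc ∏ j ∈ range n, ‖1 - a * q ^ j‖ ≤ ∏ j ∈ range n, Real.exp (‖q‖ ^ j) := by
        refine prod_le_prod (fun _ _ => norm_nonneg _) fun j _ => ?_
        calc ‖1 - a * q ^ j‖ ≤ ‖(1 : ℂ)‖ + ‖a * q ^ j‖ := norm_sub_le _ _
          _ ≤ ‖q‖ ^ j + 1 := by
            rw [norm_one, norm_mul, norm_pow]
            nlinarith [pow_nonneg (norm_nonneg q) j]
          _ ≤ _ := Real.add_one_le_exp _
    _ ≤ _ := by
      rw [← Real.exp_sum]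
      exact Real.exp_le_exp.mpr
        ((summable_geometric_of_lt_one (norm_nonneg _) hq).sum_le_tsum _ fun _ _ => by positivity)

lemma exists_norm_inv_qPoch_le {a q : ℂ} (hq : ‖q‖ < 1) (ha : ‖a‖ < 1) :
    ∃ C : ℝ, 0 ≤ C ∧ ∀ n, ‖(qPoch a q n)⁻¹‖ ≤ C := by
  obtain ⟨C, hC⟩ := ((tendsto_qPoch a hq).inv₀ (qPochInf_ne_zero hq ha)).norm.bddAbove_range
  exact ⟨C, (norm_nonneg _).trans (hC ⟨0, rfl⟩), fun n => hC ⟨n, rfl⟩⟩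

/-! ### The Askey–Wilson integral. -/

/-- The Askey–Wilson weight as a function of `z = e^{iθ}`, for arbitrary complex parameters. -/
noncomputable def awKernel (a b c d q z : ℂ) : ℂ :=
  qPochInf (z ^ 2) q * qPochInf (z⁻¹ ^ 2) q /
    (qPochInf (a * z) q * qPochInf (a * z⁻¹) q * (qPochInf (b * z) q * qPochInf (b * z⁻¹) q) *
      (qPochInf (c * z) q * qPochInf (c * z⁻¹) q) * (qPochInf (d * z) q * qPochInf (d * z⁻¹) q))

/-- The total mass of the Askey–Wilson weight on the unit circle. -/
noncomputable def awMass (a b c d q : ℂ) : ℂ :=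
  ∫ θ in (0 : ℝ)..2 * Real.pi, awKernel a b c d q (circleMap 0 1 θ)

lemma norm_mul_lt_one_of_norm_eq {p z : ℂ} (hp : ‖p‖ < 1) (hz : ‖z‖ = 1) : ‖p * z‖ < 1 := by
  rwa [norm_mul, hz, mul_one]

lemma norm_mul_inv_lt_one_of_norm_eq {p z : ℂ} (hp : ‖p‖ < 1) (hz : ‖z‖ = 1) : ‖p * z⁻¹‖ < 1 :=
  norm_mul_lt_one_of_norm_eq hp (by simp [hz])

lemma norm_circleMap_one (θ : ℝ) : ‖circleMap 0 1 θ‖ = 1 := by simp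

lemma norm_mul_lt_one {a b : ℂ} (ha : ‖a‖ < 1) (hb : ‖b‖ < 1) : ‖a * b‖ < 1 := by
  rw [norm_mul]
  nlinarith [norm_nonneg a, norm_nonneg b]

lemma norm_mul_pow_lt_one {a q : ℂ} (ha : ‖a‖ < 1) (hq : ‖q‖ < 1) (n : ℕ) : ‖a * q ^ n‖ < 1 := by
  rw [norm_mul, norm_pow]
  have := pow_le_one₀ (norm_nonneg q) hq.le (n := n)
  nlinarith [norm_nonneg a, pow_nonneg (norm_nonneg q) n]

lemma inv_qPochInf_mul {x q : ℂ} (hq : ‖q‖ < 1) (hx : ‖x‖ < 1) :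
    (qPochInf (x * q) q)⁻¹ = (qPochInf x q)⁻¹ * (1 - x) := by
  have h : 1 - x ≠ 0 := by simpa using one_sub_mul_pow_ne_zero hq.le hx 0
  rw [qPochInf_eq_mul x hq, mul_inv, mul_right_comm, inv_mul_cancel₀ h, one_mul]

lemma continuous_awKernel {X : Type*} [TopologicalSpace X] {q : ℂ} (hq : ‖q‖ < 1)
    {a b c d z : X → ℂ} (ha : Continuous a) (hb : Continuous b) (hc : Continuous c)
    (hd : Continuous d) (hz : Continuous z) (ha1 : ∀ x, ‖a x‖ < 1) (hb1 : ∀ x, ‖b x‖ < 1)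
    (hc1 : ∀ x, ‖c x‖ < 1) (hd1 : ∀ x, ‖d x‖ < 1) (hz1 : ∀ x, ‖z x‖ = 1) :
    Continuous fun x => awKernel (a x) (b x) (c x) (d x) q (z x) := by
  have hzi : Continuous fun x => (z x)⁻¹ := hz.inv₀ fun x h => by simpa [h] using hz1 x
  have aux : ∀ p : X → ℂ, Continuous p → Continuous fun x =>
      qPochInf (p x * z x) q * qPochInf (p x * (z x)⁻¹) q := fun p hp =>
    ((hp.mul hz).qPochInf hq).mul ((hp.mul hzi).qPochInf hq)
  have aux2 : ∀ p : ℂ, ‖p‖ < 1 → ∀ x, qPochInf (p * z x) q * qPochInf (p * (z x)⁻¹) q ≠ 0 :=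
    fun p hp x => mul_ne_zero (qPochInf_ne_zero hq (norm_mul_lt_one_of_norm_eq hp (hz1 x)))
      (qPochInf_ne_zero hq (norm_mul_inv_lt_one_of_norm_eq hp (hz1 x)))
  refine (((hz.pow 2).qPochInf hq).mul ((hzi.pow 2).qPochInf hq)).div
    ((((aux a ha).mul (aux b hb)).mul (aux c hc)).mul (aux d hd)) fun x => ?_
  exact mul_ne_zero (mul_ne_zero (mul_ne_zero (aux2 _ (ha1 x) x) (aux2 _ (hb1 x) x))
    (aux2 _ (hc1 x) x)) (aux2 _ (hd1 x) x)

lemma continuous_awMass {X : Type*} [TopologicalSpace X] [FirstCountableTopology X] {q : ℂ}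
    (hq : ‖q‖ < 1) {a b c d : X → ℂ} (ha : Continuous a) (hb : Continuous b) (hc : Continuous c)
    (hd : Continuous d) (ha1 : ∀ x, ‖a x‖ < 1) (hb1 : ∀ x, ‖b x‖ < 1)
    (hc1 : ∀ x, ‖c x‖ < 1) (hd1 : ∀ x, ‖d x‖ < 1) :
    Continuous fun x => awMass (a x) (b x) (c x) (d x) q := by
  refine intervalIntegral.continuous_parametric_intervalIntegral_of_continuous' ?_ _ _
  exact continuous_awKernel hq (ha.comp continuous_fst) (hb.comp continuous_fst)
    (hc.comp continuous_fst) (hd.comp continuous_fst) ((continuous_circleMap 0 1).comp continuous_snd)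
    (fun x => ha1 _) (fun x => hb1 _) (fun x => hc1 _) (fun x => hd1 _)
    fun x => norm_circleMap_one _

/-- Both sides are, up to the factor i, contour integrals of g(z) dz/z, over |z| = q and |z| = 1;
Cauchy's theorem on the annulus equates them. -/
lemma integral_circleMap_mul_eq {q : ℝ} (hq0 : 0 < q) (hq1 : q ≤ 1) {g : ℂ → ℂ}
    (hg : ∀ z : ℂ, q ≤ ‖z‖ → ‖z‖ ≤ 1 → DifferentiableAt ℂ g z) :
    ∫ θ in (0 : ℝ)..2 * Real.pi, g (q * circleMap 0 1 θ) =
      ∫ θ in (0 : ℝ)..2 * Real.pi, g (circleMap 0 1 θ) := by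
  have h := Complex.circleIntegral_sub_center_inv_smul_eq_of_differentiable_on_annulus_off_countable
    (c := 0) hq0 hq1 (f := g) Set.countable_empty
    (fun z hz => (hg z (by simpa using hz.2) (by simpa using hz.1)).continuousAt.continuousWithinAt)
    (fun z hz => hg z (by have := hz.1.2; simp at this; exact this.le)
      (by have := hz.1.1; simp at this; exact this.le))
  have aux : ∀ R : ℝ, R ≠ 0 → (∮ z in C(0, R), (z - 0)⁻¹ • g z) =
      Complex.I * ∫ θ in (0 : ℝ)..2 * Real.pi, g (R * circleMap 0 1 θ) := by
    intro R hR
    rw [circleIntegral, ← intervalIntegral.integral_const_mul]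
    refine intervalIntegral.integral_congr fun θ _ => ?_
    have h1 : circleMap 0 R θ = R * circleMap 0 1 θ := by simp [circleMap]
    have h2 : circleMap 0 R θ ≠ 0 := circleMap_ne_center hR
    simp only [deriv_circleMap, sub_zero, smul_eq_mul, ← h1]
    field_simp
  rw [aux 1 one_ne_zero, aux q hq0.ne'] at h
  simpa using (mul_left_cancel₀ Complex.I_ne_zero h).symm

/-- The `q`-difference equation of the total mass, obtained by moving the circle of integration. -/
lemma awMass_mul_left {a b c d : ℂ} {q : ℝ} (hq0 : 0 < q) (hq1 : q < 1) (ha : ‖a‖ < 1)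
    (hb : ‖b‖ < 1) (hc : ‖c‖ < 1) (hd : ‖d‖ < 1) :
    (1 - a * b * c * d) * awMass (a * q) b c d q =
      (1 - a * b) * (1 - a * c) * (1 - a * d) * awMass a b c d q := by
  have hq : ‖(q : ℂ)‖ < 1 := by rwa [Complex.norm_real, Real.norm_of_nonneg hq0.le]
  have hqC : (q : ℂ) ≠ 0 := by exact_mod_cast hq0.ne'
  -- The factors (pz;q)_∞ vanish only outside the closed unit disc and (pq/z;q)_∞ only inside |z| <
  -- q, so g has no poles on q ≤ |z| ≤ 1.
  set g : ℂ → ℂ := fun z => z * qPochInf (z ^ 2) q * qPochInf (q * z⁻¹ ^ 2) q /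
    (qPochInf (a * z) q * qPochInf (a * q * z⁻¹) q *
      (qPochInf (b * z) q * qPochInf (b * q * z⁻¹) q) *
      (qPochInf (c * z) q * qPochInf (c * q * z⁻¹) q) *
      (qPochInf (d * z) q * qPochInf (d * q * z⁻¹) q)) with hg
  have hgd : ∀ z : ℂ, q ≤ ‖z‖ → ‖z‖ ≤ 1 → DifferentiableAt ℂ g z := by
    intro z hz1 hz2
    have hz0 : z ≠ 0 := by rintro rfl; simp at hz1; linarith
    have hd1 : ∀ f : ℂ → ℂ, DifferentiableAt ℂ f z →
        DifferentiableAt ℂ (fun z => qPochInf (f z) q) z := fun f hf =>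
      (differentiable_qPochInf hq (f z)).comp z hf
    have hi : DifferentiableAt ℂ (fun z : ℂ => z⁻¹) z := differentiableAt_inv hz0
    have hp : ∀ p : ℂ, ‖p‖ < 1 → DifferentiableAt ℂ
        (fun z => qPochInf (p * z) q * qPochInf (p * q * z⁻¹) q) z ∧
        qPochInf (p * z) q * qPochInf (p * q * z⁻¹) q ≠ 0 := by
      intro p hp
      refine ⟨(hd1 _ (by fun_prop)).mul (hd1 _ (hi.const_mul _)), mul_ne_zero
        (qPochInf_ne_zero hq ?_) (qPochInf_ne_zero hq ?_)⟩
      · rw [norm_mul]; nlinarith [norm_nonneg p, norm_nonneg z]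
      · rw [norm_mul, norm_mul, Complex.norm_real, Real.norm_of_nonneg hq0.le, norm_inv, mul_assoc]
        have : q * ‖z‖⁻¹ ≤ 1 := by
          rw [← div_eq_mul_inv]; exact div_le_one_of_le₀ hz1 (norm_nonneg _)
        have h0 : 0 ≤ q * ‖z‖⁻¹ := by positivity
        nlinarith [norm_nonneg p]
    refine DifferentiableAt.div ((differentiableAt_id.mul (hd1 _ (by fun_prop))).mul
      (hd1 _ ((hi.pow 2).const_mul _))) ((((hp a ha).1.mul (hp b hb).1).mul (hp c hc).1).mul
      (hp d hd).1) ?_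
    exact mul_ne_zero (mul_ne_zero (mul_ne_zero (hp a ha).2 (hp b hb).2) (hp c hc).2) (hp d hd).2
  have hpt : ∀ z : ℂ, ‖z‖ = 1 → (1 - a * b * c * d) * awKernel (a * q) b c d q z -
      (1 - a * b) * (1 - a * c) * (1 - a * d) * awKernel a b c d q z = a * (g (q * z) - g z) := by
    intro z hz
    have hz0 : z ≠ 0 := by rintro rfl; simp at hz
    -- The infinite products common to all four terms: each term is M times a Laurent polynomial in
    -- z, so the claim becomes a rational identity.
    set M := qPochInf (z ^ 2 * q * q) q * qPochInf (z⁻¹ ^ 2 * q) q /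
      (qPochInf (a * z) q * qPochInf (a * z⁻¹) q * (qPochInf (b * z) q * qPochInf (b * z⁻¹) q) *
      (qPochInf (c * z) q * qPochInf (c * z⁻¹) q) *
      (qPochInf (d * z) q * qPochInf (d * z⁻¹) q)) with hM
    have hl : ∀ p : ℂ, ‖p‖ < 1 → (qPochInf (p * q * z) q)⁻¹ =
        (qPochInf (p * z) q)⁻¹ * (1 - p * z) := by
      intro p hp
      rw [mul_right_comm]
      exact inv_qPochInf_mul hq (norm_mul_lt_one_of_norm_eq hp hz)
    have hr : ∀ p : ℂ, ‖p‖ < 1 → (qPochInf (p * q * z⁻¹) q)⁻¹ =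
        (qPochInf (p * z⁻¹) q)⁻¹ * (1 - p * z⁻¹) := by
      intro p hp
      rw [mul_right_comm]
      exact inv_qPochInf_mul hq (norm_mul_inv_lt_one_of_norm_eq hp hz)
    have hz2 : qPochInf (z ^ 2) q = (1 - z ^ 2) * (1 - z ^ 2 * q) * qPochInf (z ^ 2 * q * q) q := by
      rw [qPochInf_eq_mul (z ^ 2) hq, qPochInf_eq_mul (z ^ 2 * q) hq]
      ring
    have hzi2 : qPochInf (z⁻¹ ^ 2) q = (1 - z⁻¹ ^ 2) * qPochInf (z⁻¹ ^ 2 * q) q :=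
      qPochInf_eq_mul (z⁻¹ ^ 2) hq
    have k1 : awKernel a b c d q z = M * ((1 - z ^ 2) * (1 - z ^ 2 * q) * (1 - z⁻¹ ^ 2)) := by
      rw [awKernel, hz2, hzi2, hM]; ring
    have k2 : awKernel (a * q) b c d q z =
        M * ((1 - z ^ 2) * (1 - z ^ 2 * q) * (1 - z⁻¹ ^ 2) * (1 - a * z) * (1 - a * z⁻¹)) := by
      rw [awKernel, hz2, hzi2, hM]
      simp only [div_eq_mul_inv, mul_inv, hl a ha, hr a ha]
      ring
    have k3 : g z = M * (z * (1 - z ^ 2) * (1 - z ^ 2 * q) * ((1 - a * z⁻¹) * (1 - b * z⁻¹) *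
        (1 - c * z⁻¹) * (1 - d * z⁻¹))) := by
      rw [hM, hg]
      simp only [div_eq_mul_inv, mul_inv, hr a ha, hr b hb, hr c hc, hr d hd, hz2,
        mul_comm (q : ℂ) (z⁻¹ ^ 2)]
      ring
    have k4 : g (q * z) = M * (q * z * (1 - (q : ℂ)⁻¹ * z⁻¹ ^ 2) * (1 - z⁻¹ ^ 2) *
        ((1 - a * z) * (1 - b * z) * (1 - c * z) * (1 - d * z))) := by
      have e1 : ∀ p : ℂ, p * (q * z) = p * q * z := fun p => by ring
      have e2 : ∀ p : ℂ, p * q * (q * z)⁻¹ = p * z⁻¹ := fun p => by field_simp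
      have e3 : ((q : ℂ) * z) ^ 2 = z ^ 2 * q * q := by ring
      have e4 : qPochInf (q * (q * z)⁻¹ ^ 2) q =
          (1 - (q : ℂ)⁻¹ * z⁻¹ ^ 2) * ((1 - z⁻¹ ^ 2) * qPochInf (z⁻¹ ^ 2 * q) q) := by
        rw [← hzi2, qPochInf_eq_mul _ hq]
        congr 2 <;> field_simp
      rw [hM, hg]
      simp only [e1, e2, e3, e4]
      simp only [div_eq_mul_inv, mul_inv, hl a ha, hl b hb, hl c hc, hl d hd]
      ring
    rw [k1, k2, k3, k4]
    field_simp
    ring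
  have hcont : ∀ p : ℂ, ‖p‖ < 1 → IntervalIntegrable
      (fun θ => awKernel p b c d q (circleMap 0 1 θ)) volume 0 (2 * Real.pi) := fun p hp =>
    (continuous_awKernel hq continuous_const continuous_const continuous_const continuous_const
      (continuous_circleMap 0 1) (fun _ => hp) (fun _ => hb) (fun _ => hc) (fun _ => hd)
      norm_circleMap_one).intervalIntegrable _ _
  have hgc : ∀ r : ℂ, q ≤ ‖r‖ → ‖r‖ ≤ 1 → IntervalIntegrable
      (fun θ => g (r * circleMap 0 1 θ)) volume 0 (2 * Real.pi) := fun r hr1 hr2 => by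
    refine Continuous.intervalIntegrable (continuous_iff_continuousAt.mpr fun θ => ?_) _ _
    exact (hgd (r * circleMap 0 1 θ) (by simpa using hr1) (by simpa using hr2)).continuousAt.comp
      (f := fun θ => r * circleMap 0 1 θ)
      (continuous_const.mul (continuous_circleMap 0 1)).continuousAt
  have haq : ‖a * q‖ < 1 := norm_mul_lt_one ha hq
  have hqn : ‖(q : ℂ)‖ = q := by rw [Complex.norm_real, Real.norm_of_nonneg hq0.le]
  have hI := integral_circleMap_mul_eq hq0 hq1.le hgd
  rw [← sub_eq_zero, awMass, awMass, ← intervalIntegral.integral_const_mul,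
    ← intervalIntegral.integral_const_mul, ← intervalIntegral.integral_sub
      ((hcont _ haq).const_mul _) ((hcont _ ha).const_mul _),
    intervalIntegral.integral_congr (fun θ _ => hpt _ (norm_circleMap_one θ)),
    intervalIntegral.integral_const_mul, intervalIntegral.integral_sub (hgc q hqn.ge hq.le)
      (by simpa using hgc 1 (by simpa using hq1.le) (by simp)), hI, sub_self, mul_zero]

lemma awMass_rotate (a b c d q : ℂ) : awMass a b c d q = awMass b c d a q := by
  simp only [awMass, awKernel]
  congr 1; ext θ; congr 1; ring

/-- The q-difference equation iterated n times relates the masses at aq^n and a; as n → ∞ the mass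
at aq^n tends to the mass at 0 by continuity. -/
lemma awMass_eq_mul_awMass_zero {a b c d : ℂ} {q : ℝ} (hq0 : 0 < q) (hq1 : q < 1) (ha : ‖a‖ < 1)
    (hb : ‖b‖ < 1) (hc : ‖c‖ < 1) (hd : ‖d‖ < 1) :
    awMass a b c d q = qPochInf (a * b * c * d) q /
      (qPochInf (a * b) q * qPochInf (a * c) q * qPochInf (a * d) q) * awMass 0 b c d q := by
  have hq : ‖(q : ℂ)‖ < 1 := by rwa [Complex.norm_real, Real.norm_of_nonneg hq0.le]
  have hpow : ∀ n : ℕ, ‖a * (q : ℂ) ^ n‖ < 1 := norm_mul_pow_lt_one ha hq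
  have key : ∀ n : ℕ, qPoch (a * b * c * d) q n * awMass (a * (q : ℂ) ^ n) b c d q =
      qPoch (a * b) q n * qPoch (a * c) q n * qPoch (a * d) q n * awMass a b c d q := by
    intro n
    induction n with
    | zero => simp [qPoch]
    | succ n ih =>
      have h := awMass_mul_left hq0 hq1 (hpow n) hb hc hd
      rw [pow_succ, ← mul_assoc a]
      simp only [qPoch_succ]
      have e : 1 - a * b * c * d * (q : ℂ) ^ n = 1 - a * (q : ℂ) ^ n * b * c * d := by ring
      rw [e, mul_assoc, h]
      linear_combination ((1 - a * (q : ℂ) ^ n * b) * (1 - a * (q : ℂ) ^ n * c) *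
        (1 - a * (q : ℂ) ^ n * d)) * ih
  have hcont : Continuous fun x : Metric.ball (0 : ℂ) 1 => awMass x b c d q :=
    continuous_awMass hq continuous_subtype_val continuous_const continuous_const continuous_const
      (fun x => mem_ball_zero_iff.mp x.2) (fun _ => hb) (fun _ => hc) (fun _ => hd)
  have hlim : Tendsto (fun n : ℕ => awMass (a * (q : ℂ) ^ n) b c d q) atTop
      (𝓝 (awMass 0 b c d q)) := by
    have h0 : Tendsto (fun n : ℕ => (⟨a * (q : ℂ) ^ n, mem_ball_zero_iff.mpr (hpow n)⟩ :
        Metric.ball (0 : ℂ) 1)) atTop (𝓝 ⟨0, by simp⟩) := by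
      rw [tendsto_subtype_rng]
      simpa using (tendsto_pow_atTop_nhds_zero_of_norm_lt_one hq).const_mul a
    have h1 := (hcont.tendsto ⟨0, by simp⟩).comp h0
    simpa only [Function.comp_def] using h1
  have h1 := tendsto_nhds_unique ((((tendsto_qPoch (a * b * c * d) hq).mul hlim)).congr key)
    ((((tendsto_qPoch (a * b) hq).mul (tendsto_qPoch (a * c) hq)).mul
      (tendsto_qPoch (a * d) hq)).mul_const _)
  have h2 := qPochInf_ne_zero hq (norm_mul_lt_one ha hb)
  have h3 := qPochInf_ne_zero hq (norm_mul_lt_one ha hc)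
  have h4 := qPochInf_ne_zero hq (norm_mul_lt_one ha hd)
  field_simp
  linear_combination -h1

/-- The mass is symmetric under rotation of its parameters, so they can be sent to 0 one after
another. -/
lemma awMass_eq_mul_awMass_zero_zero {a b c d : ℂ} {q : ℝ} (hq0 : 0 < q) (hq1 : q < 1)
    (ha : ‖a‖ < 1) (hb : ‖b‖ < 1) (hc : ‖c‖ < 1) (hd : ‖d‖ < 1) :
    awMass a b c d q = qPochInf (a * b * c * d) q /
      (qPochInf (a * b) q * qPochInf (a * c) q * qPochInf (a * d) q * qPochInf (b * c) q *
        qPochInf (b * d) q * qPochInf (c * d) q) * awMass 0 0 0 0 q := by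
  have h0 : ‖(0 : ℂ)‖ < 1 := by simp
  rw [awMass_eq_mul_awMass_zero hq0 hq1 ha hb hc hd, awMass_rotate,
    awMass_eq_mul_awMass_zero hq0 hq1 hb hc hd h0, awMass_rotate,
    awMass_eq_mul_awMass_zero hq0 hq1 hc hd h0 h0, awMass_rotate,
    awMass_eq_mul_awMass_zero hq0 hq1 hd h0 h0 h0]
  simp only [mul_zero, qPochInf_zero, mul_one, div_one, one_mul]
  field_simp

lemma integral_one_sub_circleMap_sq :
    ∫ θ in (0 : ℝ)..2 * Real.pi, (1 - circleMap 0 1 θ ^ 2) * (1 - (circleMap 0 1 θ)⁻¹ ^ 2) =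
      4 * (Real.pi : ℂ) := by
  have h : ∀ θ : ℝ, (1 - circleMap 0 1 θ ^ 2) * (1 - (circleMap 0 1 θ)⁻¹ ^ 2) =
      ((2 - 2 * Real.cos (2 * θ) : ℝ) : ℂ) := by
    intro θ
    have h0 : circleMap 0 1 θ ≠ 0 := circleMap_ne_center one_ne_zero
    have h1 : circleMap 0 1 θ ^ 2 = Complex.exp (2 * θ * Complex.I) := by
      simp [circleMap, ← Complex.exp_nat_mul]; ring_nf
    have h2 : (circleMap 0 1 θ)⁻¹ ^ 2 = Complex.exp (-(2 * θ) * Complex.I) := by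
      rw [inv_pow, h1, ← Complex.exp_neg]; ring_nf
    have h3 : Complex.exp (2 * θ * Complex.I) * Complex.exp (-(2 * θ) * Complex.I) = 1 := by
      rw [← Complex.exp_add]; simp
    push_cast
    rw [h1, h2, Complex.cos]
    linear_combination h3
  simp only [h]
  rw [intervalIntegral.integral_ofReal, intervalIntegral.integral_sub (by simp)
    (Continuous.intervalIntegrable (by fun_prop) _ _), intervalIntegral.integral_const_mul,
    intervalIntegral.integral_comp_mul_left (fun x => Real.cos x) two_ne_zero, integral_cos,
    show (2 : ℝ) * (2 * Real.pi) = ((4 : ℕ) : ℝ) * Real.pi by push_cast; ring,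
    Real.sin_nat_mul_pi]
  simp
  ring

/-- For the parameters s, -s, q, -q with s² = q, the duplication formula `qPochInf_sq` reduces the
kernel to (1 - z²)(1 - z⁻²), of integral 4π. The reduction to zero parameters is then solved for the
unknown constant. -/
lemma awMass_zero {q : ℝ} (hq0 : 0 < q) (hq1 : q < 1) :
    awMass 0 0 0 0 q = 4 * Real.pi / qPochInf q q := by
  have hq : ‖(q : ℂ)‖ < 1 := by rwa [Complex.norm_real, Real.norm_of_nonneg hq0.le]
  obtain ⟨s, hs⟩ : ∃ s : ℂ, s ^ 2 = q := IsAlgClosed.exists_pow_nat_eq _ two_pos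
  have hs1 : ‖s‖ < 1 := by
    have : ‖s‖ ^ 2 < 1 := by rw [← norm_pow, hs]; exact hq
    nlinarith [norm_nonneg s]
  have h1 : awMass s (-s) q (-q) q = 4 * Real.pi := by
    rw [awMass, ← integral_one_sub_circleMap_sq]
    refine intervalIntegral.integral_congr fun θ _ => ?_
    have hz := norm_circleMap_one θ
    set z := circleMap 0 1 θ
    have key : ∀ w : ℂ, ‖w‖ = 1 → qPochInf (w ^ 2) q = (1 - w ^ 2) * (qPochInf (s * w) q *
        qPochInf (-s * w) q * qPochInf (q * w) q * qPochInf (-q * w) q) ∧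
        (qPochInf (s * w) q *
        qPochInf (-s * w) q * qPochInf (q * w) q * qPochInf (-q * w) q) ≠ 0 := by
      intro w hw
      constructor
      · rw [qPochInf_sq hq hs, qPochInf_eq_mul w hq, qPochInf_eq_mul (-w) hq]
        ring_nf
      · have := fun p hp => qPochInf_ne_zero hq (norm_mul_lt_one_of_norm_eq (p := p) hp hw)
        exact mul_ne_zero (mul_ne_zero (mul_ne_zero (this _ hs1) (this _ (by simpa using hs1)))
          (this _ hq)) (this _ (by simpa using hq))
    have k1 := key z hz
    have k2 := key z⁻¹ (by simp [hz])
    simp only [awKernel]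
    rw [k1.1, k2.1]
    have n1 := k1.2
    have n2 := k2.2
    rw [div_eq_iff]
    · ring
    · intro h
      exact mul_ne_zero n1 n2 (by rw [← h]; ring)
  rw [awMass_eq_mul_awMass_zero_zero hq0 hq1 hs1 (by simpa using hs1) hq (by simpa using hq)] at h1
  have hqq := qPochInf_ne_zero hq hq
  -- Euler's identity: the duplication formula at x = s, with the common factor (q;q)_∞ cancelled.
  have e1 : qPochInf s q * qPochInf (-s) q * qPochInf (-q) q = 1 := by
    have h := qPochInf_sq hq hs s
    rw [← sq, hs] at h
    apply mul_left_cancel₀ hqq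
    linear_combination -h
  have e2 : qPochInf (q ^ 3) q * ((1 - q) * (1 - q ^ 2)) = qPochInf q q := by
    rw [qPochInf_eq_qPoch_mul q hq 2]
    simp [qPoch, prod_range_succ]
    ring_nf
  have e3 := qPochInf_eq_mul s hq
  have e4 := qPochInf_eq_mul (-s) hq
  have e5 := qPochInf_eq_mul (-q) hq
  have d1 : s * -s = -(q : ℂ) := by rw [← hs]; ring
  have d2 : s * -s * q * -q = (q : ℂ) ^ 3 := by rw [d1]; ring
  have d3 : s * -(q : ℂ) = -s * q := by ring
  have d4 : -s * -(q : ℂ) = s * q := by ring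
  have d5 : (q : ℂ) * -q = -q * q := by ring
  rw [d2, d1, d3, d4, d5] at h1
  have n1 := qPochInf_ne_zero hq (a := s * q) (norm_mul_lt_one hs1 hq)
  have n2 := qPochInf_ne_zero hq (a := -s * q) (norm_mul_lt_one (by simpa using hs1) hq)
  have n3 := qPochInf_ne_zero hq (a := -q * q) (norm_mul_lt_one (by simpa using hq) hq)
  have n4 := qPochInf_ne_zero hq (a := -q) (by simpa using hq)
  rw [e3, e4, e5] at e1
  rw [eq_div_iff hqq, ← h1, ← e2, e5]
  rw [e5] at n4
  have e6 := right_ne_zero_of_mul n4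
  have e7 := left_ne_zero_of_mul n4
  rw [← hs] at e1 ⊢
  rw [← hs] at n1 n2 n3 e7
  generalize qPochInf (s * s ^ 2) (s ^ 2) = S at *
  generalize qPochInf (-s * s ^ 2) (s ^ 2) = S' at *
  generalize qPochInf (-s ^ 2 * s ^ 2) (s ^ 2) = Q at *
  have e8 : (1 + s ^ 2) * Q * Q * S * S * S' * S' * ((1 - s ^ 2) * (1 - (s ^ 2) ^ 2)) = 1 := by
    linear_combination ((1 - s) * S * ((1 - -s) * S') * ((1 - -s ^ 2) * Q) + 1) * e1
  field_simp
  linear_combination (awMass 0 0 0 0 (s ^ 2) * qPochInf (s ^ 6) (s ^ 2)) * e8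

/-- The Askey–Wilson integral. -/
theorem awMass_eq {a b c d : ℂ} {q : ℝ} (hq0 : 0 < q) (hq1 : q < 1)
    (ha : ‖a‖ < 1) (hb : ‖b‖ < 1) (hc : ‖c‖ < 1) (hd : ‖d‖ < 1) :
    awMass a b c d q = 4 * Real.pi * qPochInf (a * b * c * d) q /
      (qPochInf q q * qPochInf (a * b) q * qPochInf (a * c) q * qPochInf (a * d) q *
        qPochInf (b * c) q * qPochInf (b * d) q * qPochInf (c * d) q) := by
  rw [awMass_eq_mul_awMass_zero_zero hq0 hq1 ha hb hc hd, awMass_zero hq0 hq1]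
  field_simp

/-! ### Integrals of products of Askey–Wilson polynomials. -/

/-- Since (pw;q)_n / (pw;q)_∞ = 1 / (pq^n w;q)_∞, factors of these polynomial bases are absorbed by
shifting weight parameters. -/
lemma awKernel_mul_pow {a b c d q z : ℂ} (hq : ‖q‖ < 1) (hz : ‖z‖ = 1) (ha : ‖a‖ < 1)
    (hb : ‖b‖ < 1) (j k : ℕ) :
    qPoch (a * z) q j * qPoch (a * z⁻¹) q j * (qPoch (b * z) q k * qPoch (b * z⁻¹) q k) *
      awKernel a b c d q z = awKernel (a * q ^ j) (b * q ^ k) c d q z := by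
  have h : ∀ p : ℂ, ‖p‖ < 1 → ∀ n : ℕ, ∀ w : ℂ, ‖w‖ = 1 →
      (qPochInf (p * q ^ n * w) q)⁻¹ = qPoch (p * w) q n * (qPochInf (p * w) q)⁻¹ := by
    intro p hp n w hw
    have h1 := qPoch_ne_zero hq.le (norm_mul_lt_one_of_norm_eq hp hw) n
    rw [qPochInf_eq_qPoch_mul (p * w) hq n, mul_inv, ← mul_assoc, mul_inv_cancel₀ h1, one_mul,
      mul_right_comm]
  have hzi : ‖z⁻¹‖ = 1 := by simp [hz]
  simp only [awKernel, div_eq_mul_inv, mul_inv]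
  rw [h a ha j z hz, h b hb k z hz, h a ha j _ hzi, h b hb k _ hzi]
  ring

lemma continuous_awSum {X : Type*} [TopologicalSpace X] (q : ℂ) (n : ℕ)
    {a b c d z : X → ℂ} (ha : Continuous a) (hb : Continuous b) (hc : Continuous c)
    (hd : Continuous d) (hz : Continuous z) (hz1 : ∀ x, ‖z x‖ = 1) :
    Continuous fun x => awSum (a x) (b x) (c x) (d x) q n (z x) := by
  have hzi : Continuous fun x => (z x)⁻¹ := hz.inv₀ fun x h => by simpa [h] using hz1 x
  unfold awSum qPoch
  fun_prop

lemma inv_qPochInf_mul_pow {x q : ℂ} (hq : ‖q‖ < 1) (hx : ‖x‖ < 1) (n : ℕ) :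
    (qPochInf (x * q ^ n) q)⁻¹ = qPoch x q n * (qPochInf x q)⁻¹ := by
  have h1 := qPoch_ne_zero hq.le hx n
  rw [qPochInf_eq_qPoch_mul x hq n, mul_inv, ← mul_assoc, mul_inv_cancel₀ h1, one_mul]

/-- The moments of an Askey–Wilson polynomial in the basis `(bz,b/z;q)_k`. -/
lemma integral_qPoch_mul_awSum {α b c d : ℂ} {q : ℝ} (hq0 : 0 < q) (hq1 : q < 1)
    (hα : ‖α‖ < 1) (hb : ‖b‖ < 1) (hc : ‖c‖ < 1) (hd : ‖d‖ < 1) (hα0 : α ≠ 0) (hb0 : b ≠ 0)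
    (n k : ℕ) :
    ∫ θ in (0 : ℝ)..2 * Real.pi, qPoch (b * circleMap 0 1 θ) q k *
        qPoch (b * (circleMap 0 1 θ)⁻¹) q k * awSum α b c d q n (circleMap 0 1 θ) *
        awKernel α b c d q (circleMap 0 1 θ) =
      4 * Real.pi * (-(α * b * q ^ n / q)) ^ n * qPoch (c * d) q n * qPoch (q ^ k * q / q ^ n) q n *
        qPochInf (α * b * c * d * q ^ (n + k)) q / (qPoch q q n * qPochInf q q *
        qPochInf (c * d) q * qPochInf (α * c * q ^ n) q * qPochInf (α * d * q ^ n) q *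
        qPochInf (α * b * q ^ k) q * qPochInf (b * c * q ^ k) q * qPochInf (b * d * q ^ k) q) := by
  have hq : ‖(q : ℂ)‖ < 1 := by rwa [Complex.norm_real, Real.norm_of_nonneg hq0.le]
  have hqC : (q : ℂ) ≠ 0 := by exact_mod_cast hq0.ne'
  have hint : ∀ j, IntervalIntegrable (fun θ => awKernel (α * q ^ j) (b * q ^ k) c d q
      (circleMap 0 1 θ)) volume 0 (2 * Real.pi) := fun j =>
    (continuous_awKernel hq continuous_const continuous_const continuous_const continuous_const
      (continuous_circleMap 0 1) (fun _ => norm_mul_pow_lt_one hα hq j)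
      (fun _ => norm_mul_pow_lt_one hb hq k) (fun _ => hc) (fun _ => hd)
      norm_circleMap_one).intervalIntegrable _ _
  set C : ℕ × ℕ → ℂ := fun p => (-1) ^ p.1 * (q : ℂ) ^ p.2.choose 2 *
    qPoch (α * b * c * d * q ^ n / q) q p.1 * (qPoch (α * b * q ^ p.1) q p.2 *
      qPoch (α * c * q ^ p.1) q p.2 * qPoch (α * d * q ^ p.1) q p.2) /
      (qPoch q q p.1 * qPoch q q p.2) with hC
  have h1 : ∀ θ : ℝ, qPoch (b * circleMap 0 1 θ) q k *
        qPoch (b * (circleMap 0 1 θ)⁻¹) q k * awSum α b c d q n (circleMap 0 1 θ) *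
        awKernel α b c d q (circleMap 0 1 θ) = ∑ p ∈ antidiagonal n,
          C p * awKernel (α * q ^ p.1) (b * q ^ k) c d q (circleMap 0 1 θ) := by
    intro θ
    rw [awSum, mul_sum, sum_mul]
    refine sum_congr rfl fun p _ => ?_
    rw [← awKernel_mul_pow hq (norm_circleMap_one θ) hα hb, hC]
    ring
  simp only [h1]
  rw [intervalIntegral.integral_finsetSum fun p _ => (hint p.1).const_mul _]
  simp only [intervalIntegral.integral_const_mul]
  set K := 4 * Real.pi * qPochInf (α * b * c * d * q ^ (n + k)) q / (qPochInf q q *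
        qPochInf (c * d) q * qPochInf (α * c * q ^ n) q * qPochInf (α * d * q ^ n) q *
        qPochInf (α * b * q ^ k) q * qPochInf (b * c * q ^ k) q * qPochInf (b * d * q ^ k) q) with hK
  -- Each term is a shifted Askey–Wilson integral. Once everything independent of j is moved into K,
  -- the sum has the shape of `qSaalschutz_reverse`.
  have h2 : ∀ p ∈ antidiagonal n, C p * ∫ θ in (0 : ℝ)..2 * Real.pi,
      awKernel (α * q ^ p.1) (b * q ^ k) c d q (circleMap 0 1 θ) =
      K * ((-1) ^ p.1 * (q : ℂ) ^ p.2.choose 2 * qPoch (α * b * c * d * q ^ n / q) q p.1 *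
        qPoch (α * b * q ^ k) q p.1 * qPoch (α * b * q ^ p.1) q p.2 *
        qPoch (α * b * c * d * q ^ k * q ^ p.1) q p.2 / (qPoch q q p.1 * qPoch q q p.2)) := by
    rintro ⟨j, i⟩ hp
    have hji : j + i = n := HasAntidiagonal.mem_antidiagonal.mp hp
    dsimp only
    have h3 := awMass_eq hq0 hq1 (norm_mul_pow_lt_one hα hq j) (norm_mul_pow_lt_one hb hq k) hc hd
    rw [awMass] at h3
    rw [h3]
    have e1 : α * (q : ℂ) ^ j * (b * q ^ k) * c * d = α * b * c * d * q ^ k * q ^ j := by ring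
    have e2 : α * (q : ℂ) ^ j * (b * q ^ k) = α * b * q ^ k * q ^ j := by ring
    have e3 : qPochInf (α * b * c * d * q ^ k * q ^ j) q =
        qPoch (α * b * c * d * q ^ k * q ^ j) q i * qPochInf (α * b * c * d * q ^ (n + k)) q := by
      rw [qPochInf_eq_qPoch_mul _ hq i, ← hji]; ring_nf
    have e4 : ∀ p : ℂ, ‖p‖ < 1 → (qPochInf (α * q ^ j * p) q)⁻¹ * qPoch (α * p * q ^ j) q i =
        (qPochInf (α * p * q ^ n) q)⁻¹ := by
      intro p hp
      rw [← hji, pow_add, ← mul_assoc, inv_qPochInf_mul_pow (x := α * p * q ^ j) hq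
        (norm_mul_pow_lt_one (norm_mul_lt_one hα hp) hq j), mul_comm, mul_right_comm α]
    have e5 : ∀ p : ℂ, b * (q : ℂ) ^ k * p = b * p * q ^ k := fun p => by ring
    have e6 := inv_qPochInf_mul_pow hq (norm_mul_pow_lt_one (norm_mul_lt_one hα hb) hq k) j
    rw [hC, hK, e1, e2, e3, e5, e5]
    simp only [div_eq_mul_inv, mul_inv, e6, ← e4 c hc, ← e4 d hd]
    ring
  rw [sum_congr rfl h2, ← mul_sum, qSaalschutz_reverse hq hqC _ _ _ _ _ (mul_ne_zero hα0 hb0)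
    (by field_simp)]
  have e1 : α * b * c * d * q ^ n / q * (q / (α * b * q ^ n)) = c * d := by field_simp
  have e2 : α * b * q ^ k * (q / (α * b * q ^ n)) = (q : ℂ) ^ k * q / q ^ n := by field_simp
  rw [e1, e2, hK]
  generalize (-(α * b * q ^ n / q)) ^ n = W
  simp only [div_eq_mul_inv, mul_inv]
  ring

lemma sum_antidiagonal_add_of_eq_zero {M : Type*} [AddCommMonoid M] (f : ℕ → ℕ → M) (n r : ℕ)
    (hf : ∀ j < n, ∀ i, f j i = 0) :
    ∑ p ∈ antidiagonal (n + r), f p.1 p.2 = ∑ p ∈ antidiagonal r, f (n + p.1) p.2 := by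
  induction n generalizing f with
  | zero => simp
  | succ n ih =>
    rw [show n + 1 + r = n + r + 1 by ring, Nat.sum_antidiagonal_succ, hf 0 (by omega), zero_add,
      ih (fun j i => f (j + 1) i) fun j hj i => hf (j + 1) (by omega) i]
    refine sum_congr rfl fun p _ => ?_
    congr 1
    ring

/-- The factor of index n - 1 - j is 1 - 1. This zero is the source of the orthogonality to lower
degrees. -/
lemma qPoch_pow_eq_zero {q : ℂ} (hq0 : q ≠ 0) {j n : ℕ} (h : j < n) :
    qPoch (q ^ j * q / q ^ n) q n = 0 := by
  refine prod_eq_zero (i := n - 1 - j) (by simp; omega) ?_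
  rw [sub_eq_zero, div_mul_eq_mul_div, eq_div_iff (pow_ne_zero _ hq0), one_mul, mul_assoc,
    ← pow_succ', ← pow_add]
  congr 1
  omega

lemma continuous_awIntegrand {q : ℂ} (hq : ‖q‖ < 1) {a b c d α : ℂ} (hα : ‖α‖ < 1)
    (hb : ‖b‖ < 1) (hc : ‖c‖ < 1) (hd : ‖d‖ < 1) (m n : ℕ) :
    Continuous fun θ : ℝ => awSum b a c d q m (circleMap 0 1 θ) *
      awSum α b c d q n (circleMap 0 1 θ) * awKernel α b c d q (circleMap 0 1 θ) :=
  ((continuous_awSum q m continuous_const continuous_const continuous_const continuous_const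
    (continuous_circleMap 0 1) norm_circleMap_one).mul
    (continuous_awSum q n continuous_const continuous_const continuous_const continuous_const
    (continuous_circleMap 0 1) norm_circleMap_one)).mul
    (continuous_awKernel hq continuous_const continuous_const continuous_const continuous_const
      (continuous_circleMap 0 1) (fun _ => hα) (fun _ => hb) (fun _ => hc) (fun _ => hd)
      norm_circleMap_one)

/-- The polynomial of degree m is expanded in the base b rather than a, because b is a parameter of
the weight and a is not. -/
lemma integral_awSum_mul_awSum_eq_sum {a α b c d : ℂ} {q : ℝ} (hq0 : 0 < q) (hq1 : q < 1)
    (hα : ‖α‖ < 1) (hb : ‖b‖ < 1) (hc : ‖c‖ < 1) (hd : ‖d‖ < 1) (m n : ℕ) :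
    ∫ θ in (0 : ℝ)..2 * Real.pi, awSum b a c d q m (circleMap 0 1 θ) *
        awSum α b c d q n (circleMap 0 1 θ) * awKernel α b c d q (circleMap 0 1 θ) =
      ∑ p ∈ antidiagonal m, (-1) ^ p.1 * (q : ℂ) ^ p.2.choose 2 *
        qPoch (b * a * c * d * q ^ m / q) q p.1 * (qPoch (b * a * q ^ p.1) q p.2 *
          qPoch (b * c * q ^ p.1) q p.2 * qPoch (b * d * q ^ p.1) q p.2) /
          (qPoch q q p.1 * qPoch q q p.2) *
        ∫ θ in (0 : ℝ)..2 * Real.pi, qPoch (b * circleMap 0 1 θ) q p.1 *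
          qPoch (b * (circleMap 0 1 θ)⁻¹) q p.1 * awSum α b c d q n (circleMap 0 1 θ) *
          awKernel α b c d q (circleMap 0 1 θ) := by
  have hq : ‖(q : ℂ)‖ < 1 := by rwa [Complex.norm_real, Real.norm_of_nonneg hq0.le]
  have hzc := continuous_circleMap 0 1
  have hzi : Continuous fun θ => (circleMap 0 1 θ)⁻¹ := hzc.inv₀ fun x => circleMap_ne_center one_ne_zero
  simp only [← intervalIntegral.integral_const_mul]
  rw [← intervalIntegral.integral_finsetSum]
  · refine intervalIntegral.integral_congr fun θ _ => ?_
    rw [awSum, mul_assoc, sum_mul]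
    refine sum_congr rfl fun p _ => ?_
    ring
  · intro p _
    refine Continuous.intervalIntegrable (continuous_const.mul ?_) _ _
    exact ((((continuous_const.mul hzc).qPoch q p.1).mul ((continuous_const.mul hzi).qPoch q p.1)).mul
      (continuous_awSum q n continuous_const continuous_const continuous_const continuous_const
        hzc norm_circleMap_one)).mul
      (continuous_awKernel hq continuous_const continuous_const continuous_const continuous_const
        hzc (fun _ => hα) (fun _ => hb) (fun _ => hc) (fun _ => hd) norm_circleMap_one)

lemma integral_awSum_mul_awSum_of_lt {a α b c d : ℂ} {q : ℝ} (hq0 : 0 < q) (hq1 : q < 1)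
    (hα : ‖α‖ < 1) (hb : ‖b‖ < 1) (hc : ‖c‖ < 1) (hd : ‖d‖ < 1) (hα0 : α ≠ 0) (hb0 : b ≠ 0)
    {m n : ℕ} (hmn : m < n) :
    ∫ θ in (0 : ℝ)..2 * Real.pi, awSum b a c d q m (circleMap 0 1 θ) *
        awSum α b c d q n (circleMap 0 1 θ) * awKernel α b c d q (circleMap 0 1 θ) = 0 := by
  rw [integral_awSum_mul_awSum_eq_sum hq0 hq1 hα hb hc hd]
  refine sum_eq_zero fun p hp => ?_
  have hp' := HasAntidiagonal.mem_antidiagonal.mp hp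
  rw [integral_qPoch_mul_awSum hq0 hq1 hα hb hc hd hα0 hb0,
    qPoch_pow_eq_zero (by exact_mod_cast hq0.ne') (by omega)]
  simp

/-- The integral of two Askey–Wilson polynomials whose parameters differ in one place. -/
lemma integral_awSum_mul_awSum {a α b c d : ℂ} {q : ℝ} (hq0 : 0 < q) (hq1 : q < 1)
    (hα : ‖α‖ < 1) (hb : ‖b‖ < 1) (hc : ‖c‖ < 1) (hd : ‖d‖ < 1) (hα0 : α ≠ 0)
    (hb0 : b ≠ 0) (hc0 : c ≠ 0) (hd0 : d ≠ 0) (n r : ℕ) :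
    ∫ θ in (0 : ℝ)..2 * Real.pi, awSum b a c d q (n + r) (circleMap 0 1 θ) *
        awSum α b c d q n (circleMap 0 1 θ) * awKernel α b c d q (circleMap 0 1 θ) =
      4 * Real.pi * (α * b * q ^ n / q) ^ n * (α * b * q ^ n) ^ r * q ^ r.choose 2 *
        qPoch (c * d) q n * qPoch (c * d * q ^ n) q r * qPoch (a / α) q r *
        qPoch (a * b * c * d * q ^ (n + r) / q) q n * qPochInf (α * b * c * d * q ^ (2 * n + r)) q /
        (qPoch q q n * qPoch q q r * qPochInf q q * qPochInf (c * d) q *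
          qPochInf (α * b * q ^ n) q * qPochInf (α * c * q ^ n) q * qPochInf (α * d * q ^ n) q *
          qPochInf (b * c * q ^ (n + r)) q * qPochInf (b * d * q ^ (n + r)) q) := by
  have hq : ‖(q : ℂ)‖ < 1 := by rwa [Complex.norm_real, Real.norm_of_nonneg hq0.le]
  have hqC : (q : ℂ) ≠ 0 := by exact_mod_cast hq0.ne'
  rw [integral_awSum_mul_awSum_eq_sum hq0 hq1 hα hb hc hd]
  simp only [integral_qPoch_mul_awSum hq0 hq1 hα hb hc hd hα0 hb0]
  -- The moments of index below n vanish, so the summation index is rewritten as n + k with k + i =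
  -- r.
  rw [sum_antidiagonal_add_of_eq_zero (fun j i => (-1) ^ j * (q : ℂ) ^ i.choose 2 *
    qPoch (b * a * c * d * q ^ (n + r) / q) q j * (qPoch (b * a * q ^ j) q i *
      qPoch (b * c * q ^ j) q i * qPoch (b * d * q ^ j) q i) / (qPoch q q j * qPoch q q i) *
    (4 * Real.pi * (-(α * b * q ^ n / q)) ^ n * qPoch (c * d) q n * qPoch (q ^ j * q / q ^ n) q n *
      qPochInf (α * b * c * d * q ^ (n + j)) q / (qPoch q q n * qPochInf q q *
      qPochInf (c * d) q * qPochInf (α * c * q ^ n) q * qPochInf (α * d * q ^ n) q *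
      qPochInf (α * b * q ^ j) q * qPochInf (b * c * q ^ j) q * qPochInf (b * d * q ^ j) q)))]
  swap
  · intro j hj i
    rw [qPoch_pow_eq_zero hqC hj]
    simp
  set K := 4 * Real.pi * (α * b * q ^ n / q) ^ n * qPoch (c * d) q n *
    qPoch (a * b * c * d * q ^ (n + r) / q) q n * qPochInf (α * b * c * d * q ^ (2 * n + r)) q /
    (qPoch q q n * qPochInf q q * qPochInf (c * d) q *
      qPochInf (α * b * q ^ n) q * qPochInf (α * c * q ^ n) q * qPochInf (α * d * q ^ n) q *
      qPochInf (b * c * q ^ (n + r)) q * qPochInf (b * d * q ^ (n + r)) q) with hK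
  set A := a * b * c * d * q ^ (n + r) / q * q ^ n with hA
  set G := α * b * c * d * q ^ (2 * n) with hG
  have h2 : ∀ p ∈ antidiagonal r, (-1) ^ (n + p.1) * (q : ℂ) ^ p.2.choose 2 *
      qPoch (b * a * c * d * q ^ (n + r) / q) q (n + p.1) * (qPoch (b * a * q ^ (n + p.1)) q p.2 *
        qPoch (b * c * q ^ (n + p.1)) q p.2 * qPoch (b * d * q ^ (n + p.1)) q p.2) /
        (qPoch q q (n + p.1) * qPoch q q p.2) *
      (4 * Real.pi * (-(α * b * q ^ n / q)) ^ n * qPoch (c * d) q n *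
        qPoch (q ^ (n + p.1) * q / q ^ n) q n *
        qPochInf (α * b * c * d * q ^ (n + (n + p.1))) q / (qPoch q q n * qPochInf q q *
        qPochInf (c * d) q * qPochInf (α * c * q ^ n) q * qPochInf (α * d * q ^ n) q *
        qPochInf (α * b * q ^ (n + p.1)) q * qPochInf (b * c * q ^ (n + p.1)) q *
        qPochInf (b * d * q ^ (n + p.1)) q)) =
      K * ((-1) ^ p.1 * (q : ℂ) ^ p.2.choose 2 * qPoch A q p.1 * qPoch (α * b * q ^ n) q p.1 *
        qPoch (G * q ^ p.1) q p.2 * qPoch (a * b * q ^ n * q ^ p.1) q p.2 /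
        (qPoch q q p.1 * qPoch q q p.2)) := by
    rintro ⟨k, i⟩ hp
    have hki : k + i = r := HasAntidiagonal.mem_antidiagonal.mp hp
    dsimp only
    have e1 : qPochInf (α * b * c * d * q ^ (n + (n + k))) q =
        qPoch (G * q ^ k) q i * qPochInf (α * b * c * d * q ^ (2 * n + r)) q := by
      rw [qPochInf_eq_qPoch_mul _ hq i, hG, ← hki]; ring_nf
    have e2 : ∀ p : ℂ, ‖p‖ < 1 → (qPochInf (b * p * q ^ (n + k)) q)⁻¹ *
        qPoch (b * p * q ^ (n + k)) q i = (qPochInf (b * p * q ^ (n + r)) q)⁻¹ := by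
      intro p hp
      rw [← hki, ← add_assoc, pow_add _ (n + k), ← mul_assoc, inv_qPochInf_mul_pow
        (x := b * p * q ^ (n + k)) hq (norm_mul_pow_lt_one (norm_mul_lt_one hb hp) hq _), mul_comm]
    have e3 : (qPochInf (α * b * q ^ (n + k)) q)⁻¹ =
        qPoch (α * b * q ^ n) q k * (qPochInf (α * b * q ^ n) q)⁻¹ := by
      rw [pow_add, ← mul_assoc, inv_qPochInf_mul_pow hq
        (norm_mul_pow_lt_one (norm_mul_lt_one hα hb) hq n)]
    have e4 : qPoch (b * a * c * d * q ^ (n + r) / q) q (n + k) =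
        qPoch (a * b * c * d * q ^ (n + r) / q) q n * qPoch A q k := by
      rw [qPoch_add, hA, mul_comm b a]
    have e5 : (q : ℂ) ^ (n + k) * q / q ^ n = q * q ^ k := by rw [pow_add]; field_simp
    have e6 : (qPoch (q : ℂ) q (n + k))⁻¹ * qPoch ((q : ℂ) * q ^ k) q n = (qPoch (q : ℂ) q k)⁻¹ := by
      have h1 := qPoch_ne_zero hq.le (norm_mul_pow_lt_one hq hq k) n
      rw [add_comm n k, qPoch_add, mul_inv, inv_mul_cancel_right₀ h1]
    have e7 : b * a * (q : ℂ) ^ (n + k) = a * b * q ^ n * q ^ k := by ring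
    rw [e1, e4, e5, e7, hK, neg_pow (α * b * q ^ n / q), pow_add (-1 : ℂ)]
    generalize (α * b * q ^ n / q) ^ n = W
    simp only [div_eq_mul_inv, mul_inv, e3, ← e2 c hc, ← e2 d hd, ← e6]
    rcases neg_one_pow_eq_or ℂ n with h | h <;> rw [h] <;> ring
  have hG0 : G ≠ 0 := by rw [hG]; positivity
  -- The second Saalschütz sum. Its two products are (a/α;q)_r and (q/(cdq^{n+r});q)_r; the latter
  -- is reversed to (cdq^n;q)_r.
  rw [sum_congr rfl h2, ← mul_sum, qSaalschutz_reverse hq hqC _ _ _ _ _ hG0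
    (by rw [hA, hG]; field_simp; ring)]
  have e1 : A * (q / (G * q ^ r)) = a / α := by rw [hA, hG]; field_simp; ring
  have e2 : α * b * q ^ n * (q / (G * q ^ r)) = q / (c * d * q ^ (n + r)) := by
    rw [hG]; field_simp; ring
  have e3 : -(G * q ^ r / q) * -(q / (c * d * q ^ (n + r))) = α * b * q ^ n := by
    rw [hG]; field_simp; ring
  have e4 : (α * b * (q : ℂ) ^ n) ^ r =
      (-(G * q ^ r / q)) ^ r * (-(q / (c * d * q ^ (n + r)))) ^ r := by
    rw [← mul_pow, e3]
  rw [e1, e2, qPoch_reverse (y := q / (c * d * q ^ (n + r))) (x := c * d * q ^ n) hqC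
    (by field_simp; ring), e4, hK]
  generalize (-(G * q ^ r / q)) ^ r = W
  generalize (α * b * q ^ n / q) ^ n = W'
  generalize (-(q / (c * d * q ^ (n + r)))) ^ r = W''
  simp only [div_eq_mul_inv, mul_inv]
  ring

/-! ### Integrals of the generating coefficients, including vanishing parameters. -/

lemma awSum_inv (a b c d q : ℂ) (n : ℕ) (z : ℂ) : awSum a b c d q n z⁻¹ = awSum a b c d q n z := by
  simp only [awSum, inv_inv, mul_comm (qPoch (a * z⁻¹) q _)]

lemma awKernel_inv (a b c d q z : ℂ) : awKernel a b c d q z⁻¹ = awKernel a b c d q z := by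
  simp only [awKernel, inv_inv]
  congr 1 <;> ring

lemma integral_circleMap_eq_two_mul {f : ℂ → ℂ} (hf : Continuous fun θ : ℝ => f (circleMap 0 1 θ))
    (hs : ∀ z, f z⁻¹ = f z) :
    ∫ θ in (0 : ℝ)..2 * Real.pi, f (circleMap 0 1 θ) =
      2 * ∫ θ in (0 : ℝ)..Real.pi, f (circleMap 0 1 θ) := by
  have h1 : ∀ θ : ℝ, circleMap 0 1 (2 * Real.pi - θ) = (circleMap 0 1 θ)⁻¹ := by
    intro θ
    simp [circleMap, sub_mul, Complex.exp_sub, ← Complex.exp_neg]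
  have h2 := intervalIntegral.integral_comp_sub_left (a := 0) (b := Real.pi)
    (fun θ => f (circleMap 0 1 θ)) (2 * Real.pi)
  simp only [h1, hs] at h2
  rw [sub_zero, show 2 * Real.pi - Real.pi = Real.pi by ring] at h2
  rw [← intervalIntegral.integral_add_adjacent_intervals (hf.intervalIntegrable 0 Real.pi)
    (hf.intervalIntegrable _ _), ← h2, ← two_mul]

/-- The value of the integral of `awGenCoeff` of degree `n + r` against an Askey–Wilson polynomial
of degree `n`. -/
noncomputable def awGenMoment (a α b c d q : ℂ) (n r : ℕ) : ℂ :=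
  2 * Real.pi * α ^ (n + r) * q ^ n.choose 2 * qPoch (a * b * c * d * q ^ (n + r) / q) q n *
    qPoch (a / α) q r * qPochInf (α * b * c * d * q ^ (2 * n + r)) q /
    (qPoch q q n * qPoch (a * b) q (n + r) * qPoch q q r * qPochInf q q * qPochInf (c * d) q *
      qPochInf (α * b * q ^ n) q * qPochInf (α * c * q ^ n) q * qPochInf (α * d * q ^ n) q *
      qPochInf (b * c * q ^ (n + r)) q * qPochInf (b * d * q ^ (n + r)) q)

lemma continuous_awGenCoeff {X : Type*} [TopologicalSpace X] {q : ℂ} (hq : ‖q‖ < 1) (m : ℕ)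
    {a b c d z : X → ℂ} (ha : Continuous a) (hb : Continuous b) (hc : Continuous c)
    (hd : Continuous d) (hz : Continuous z) (ha1 : ∀ x, ‖a x‖ < 1) (hb1 : ∀ x, ‖b x‖ < 1)
    (hc1 : ∀ x, ‖c x‖ < 1) (hd1 : ∀ x, ‖d x‖ < 1) (hz1 : ∀ x, ‖z x‖ = 1) :
    Continuous fun x => awGenCoeff (a x) (b x) (c x) (d x) q m (z x) := by
  have hzi : Continuous fun x => (z x)⁻¹ := hz.inv₀ fun x h => by simpa [h] using hz1 x
  have hqne : ∀ n, qPoch q q n ≠ 0 := qPoch_ne_zero hq.le hq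
  unfold awGenCoeff
  refine continuous_finsetSum _ fun p _ => ?_
  refine (((((ha.mul hz).qPoch q _).mul ((hb.mul hz).qPoch q _)).div
    (continuous_const.mul ((ha.mul hb).qPoch q _)) fun x => ?_).mul (hzi.pow _)).mul
    (((((hc.mul hzi).qPoch q _).mul ((hd.mul hzi).qPoch q _)).div
    (continuous_const.mul ((hc.mul hd).qPoch q _)) fun x => ?_).mul (hz.pow _))
  · exact mul_ne_zero (hqne _) (qPoch_ne_zero hq.le (norm_mul_lt_one (ha1 x) (hb1 x)) _)
  · exact mul_ne_zero (hqne _) (qPoch_ne_zero hq.le (norm_mul_lt_one (hc1 x) (hd1 x)) _)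

/-- The closed form contains no inverse power of b, c or d, so it stays continuous where these
vanish. -/
lemma continuous_awGenMoment {X : Type*} [TopologicalSpace X] {q : ℂ} (hq : ‖q‖ < 1) (n r : ℕ)
    {a α : ℂ} {b c d : X → ℂ} (hb : Continuous b) (hc : Continuous c) (hd : Continuous d)
    (ha1 : ‖a‖ < 1) (hα1 : ‖α‖ < 1) (hb1 : ∀ x, ‖b x‖ < 1)
    (hc1 : ∀ x, ‖c x‖ < 1) (hd1 : ∀ x, ‖d x‖ < 1) :
    Continuous fun x => awGenMoment a α (b x) (c x) (d x) q n r := by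
  have hqne : ∀ n, qPoch q q n ≠ 0 := qPoch_ne_zero hq.le hq
  have hqinf := qPochInf_ne_zero hq hq
  have hne : ∀ x y : ℂ, ‖x‖ < 1 → ‖y‖ < 1 → ∀ n : ℕ, qPochInf (x * y * q ^ n) q ≠ 0 :=
    fun x y hx hy n => qPochInf_ne_zero hq (norm_mul_pow_lt_one (norm_mul_lt_one hx hy) hq n)
  unfold awGenMoment
  refine Continuous.div ?_ ?_ fun x => ?_
  · refine ((continuous_const.mul ?_).mul continuous_const).mul ?_
    · exact Continuous.qPoch q n (by fun_prop)
    · exact Continuous.qPochInf hq (by fun_prop)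
  · refine (((((((continuous_const.mul ?_).mul continuous_const).mul continuous_const).mul ?_).mul
      ?_).mul ?_).mul ?_).mul ?_ |>.mul ?_
    · exact Continuous.qPoch q _ (by fun_prop)
    all_goals exact Continuous.qPochInf hq (by fun_prop)
  · have h1 := qPoch_ne_zero hq.le (norm_mul_lt_one ha1 (hb1 x)) (n + r)
    have h2 := qPochInf_ne_zero hq (norm_mul_lt_one (hc1 x) (hd1 x))
    have h3 := hne _ _ hα1 (hb1 x) n
    have h4 := hne _ _ hα1 (hc1 x) n
    have h5 := hne _ _ hα1 (hd1 x) n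
    have h6 := hne _ _ (hb1 x) (hc1 x) (n + r)
    have h7 := hne _ _ (hb1 x) (hd1 x) (n + r)
    have h8 := hqne n
    have h9 := hqne r
    simp only [ne_eq, mul_eq_zero, not_or]
    tauto

/-- The integral over the half circle of the generating coefficient against an Askey–Wilson
polynomial. -/
noncomputable def awGenIntegral (a α b c d q : ℂ) (m n : ℕ) : ℂ :=
  ∫ θ in (0 : ℝ)..Real.pi, awGenCoeff a b c d q m (circleMap 0 1 θ) *
    awSum α b c d q n (circleMap 0 1 θ) * awKernel α b c d q (circleMap 0 1 θ)

lemma continuous_awGenIntegral {X : Type*} [TopologicalSpace X] [FirstCountableTopology X] {q : ℂ}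
    (hq : ‖q‖ < 1) (m n : ℕ) {a α : ℂ} {b c d : X → ℂ} (hb : Continuous b) (hc : Continuous c)
    (hd : Continuous d) (ha1 : ‖a‖ < 1) (hα1 : ‖α‖ < 1) (hb1 : ∀ x, ‖b x‖ < 1)
    (hc1 : ∀ x, ‖c x‖ < 1) (hd1 : ∀ x, ‖d x‖ < 1) :
    Continuous fun x => awGenIntegral a α (b x) (c x) (d x) q m n := by
  refine intervalIntegral.continuous_parametric_intervalIntegral_of_continuous' ?_ _ _
  have hb' := hb.comp (continuous_fst (X := X) (Y := ℝ))
  have hc' := hc.comp (continuous_fst (X := X) (Y := ℝ))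
  have hd' := hd.comp (continuous_fst (X := X) (Y := ℝ))
  have hz := (continuous_circleMap 0 1).comp (continuous_snd (X := X) (Y := ℝ))
  exact ((continuous_awGenCoeff hq m continuous_const hb' hc' hd' hz (fun _ => ha1)
    (fun x => hb1 _) (fun x => hc1 _) (fun x => hd1 _) fun x => norm_circleMap_one _).mul
    (continuous_awSum q n continuous_const hb' hc' hd' hz fun x => norm_circleMap_one _)).mul
    (continuous_awKernel hq continuous_const hb' hc' hd' hz (fun _ => hα1)
    (fun x => hb1 _) (fun x => hc1 _) (fun x => hd1 _) fun x => norm_circleMap_one _)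

/-- The generating coefficient is not visibly invariant under z ↦ 1/z. Sears' transformation
exhibits this invariance, so the half circle contributes half of the full integral. -/
lemma awGenIntegral_of_ne_zero {a α b c d : ℂ} {q : ℝ} (hq0 : 0 < q) (hq1 : q < 1) (ha : ‖a‖ < 1)
    (hα : ‖α‖ < 1) (hb : ‖b‖ < 1) (hc : ‖c‖ < 1) (hd : ‖d‖ < 1)
    (hb0 : b ≠ 0) (hc0 : c ≠ 0) (hd0 : d ≠ 0) (m n : ℕ) :
    awGenIntegral a α b c d q m n =
      (2 * (b ^ m * q ^ m.choose 2) * (qPoch (a * b) q m * qPoch (c * d) q m))⁻¹ *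
      ∫ θ in (0 : ℝ)..2 * Real.pi, awSum b a c d q m (circleMap 0 1 θ) *
        awSum α b c d q n (circleMap 0 1 θ) * awKernel α b c d q (circleMap 0 1 θ) := by
  have hq : ‖(q : ℂ)‖ < 1 := by rwa [Complex.norm_real, Real.norm_of_nonneg hq0.le]
  have hqC : (q : ℂ) ≠ 0 := by exact_mod_cast hq0.ne'
  have hab := qPoch_ne_zero hq.le (norm_mul_lt_one ha hb) m
  have hcd := qPoch_ne_zero hq.le (norm_mul_lt_one hc hd) m
  have h1 : ∀ z : ℂ, z ≠ 0 → awGenCoeff a b c d q m z =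
      ((b ^ m * q ^ m.choose 2) * (qPoch (a * b) q m * qPoch (c * d) q m))⁻¹ *
        awSum b a c d q m z := by
    intro z hz
    have h := awGenCoeff_eq_awSum hq hqC hb0 hc0 hd0 hz (norm_mul_lt_one ha hb)
      (norm_mul_lt_one hc hd) m
    rw [mul_inv, mul_right_comm, ← h, mul_comm _ (_)⁻¹, inv_mul_cancel_left₀ (mul_ne_zero hab hcd)]
  have h2 : ∀ θ : ℝ, circleMap 0 1 θ ≠ 0 := fun θ => circleMap_ne_center one_ne_zero
  rw [integral_circleMap_eq_two_mul (f := fun z => awSum b a c d q m z * awSum α b c d q n z *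
    awKernel α b c d q z) (continuous_awIntegrand hq hα hb hc hd m n)
    fun z => by simp only [awSum_inv, awKernel_inv], awGenIntegral,
    ← intervalIntegral.integral_const_mul, ← intervalIntegral.integral_const_mul]
  refine intervalIntegral.integral_congr fun θ _ => ?_
  simp only [h1 _ (h2 θ), mul_inv]
  ring

/-- Extension by continuity of an identity from nonzero parameters to all parameters in the unit
disc. -/
lemma eq_of_continuousOn_of_ne_zero {f g : ℂ → ℂ → ℂ → ℂ} {b c d : ℂ}
    (hb : ‖b‖ < 1) (hc : ‖c‖ < 1) (hd : ‖d‖ < 1)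
    (hf : ContinuousOn (fun x => f (b + x) (c + x) (d + x))
      {x | ‖b + x‖ < 1 ∧ ‖c + x‖ < 1 ∧ ‖d + x‖ < 1})
    (hg : ContinuousOn (fun x => g (b + x) (c + x) (d + x))
      {x | ‖b + x‖ < 1 ∧ ‖c + x‖ < 1 ∧ ‖d + x‖ < 1})
    (h : ∀ b c d, ‖b‖ < 1 → ‖c‖ < 1 → ‖d‖ < 1 → b ≠ 0 → c ≠ 0 → d ≠ 0 → f b c d = g b c d) :
    f b c d = g b c d := by
  have hopen : IsOpen {x : ℂ | ‖b + x‖ < 1 ∧ ‖c + x‖ < 1 ∧ ‖d + x‖ < 1} :=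
    ((isOpen_lt (f := fun x : ℂ => ‖b + x‖) (by fun_prop) continuous_const).inter
      ((isOpen_lt (f := fun x : ℂ => ‖c + x‖) (by fun_prop) continuous_const).inter
        (isOpen_lt (f := fun x : ℂ => ‖d + x‖) (by fun_prop) continuous_const)) :)
  have hmem := hopen.mem_nhds (x := 0) (by simp [hb, hc, hd])
  -- One common shift x suffices: p + x vanishes at most at x = -p, so b + x, c + x, d + x are all
  -- nonzero for small x ≠ 0.
  have hne : ∀ p : ℂ, ∀ᶠ x in 𝓝[≠] (0 : ℂ), p + x ≠ 0 := by
    intro p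
    rcases eq_or_ne p 0 with rfl | hp
    · filter_upwards [self_mem_nhdsWithin] with x hx
      simpa using hx
    · have : ContinuousAt (fun x => p + x) 0 := by fun_prop
      exact (this.eventually_ne (by simpa using hp)).filter_mono nhdsWithin_le_nhds
  have hev : ∀ᶠ x in 𝓝[≠] (0 : ℂ), f (b + x) (c + x) (d + x) = g (b + x) (c + x) (d + x) := by
    filter_upwards [hne b, hne c, hne d, mem_nhdsWithin_of_mem_nhds hmem] with x h1 h2 h3 h4
    exact h _ _ _ h4.1 h4.2.1 h4.2.2 h1 h2 h3
  have h1 : Tendsto (fun x => f (b + x) (c + x) (d + x)) (𝓝[≠] 0) (𝓝 (f (b + 0) (c + 0) (d + 0))) :=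
    (hf.continuousAt hmem).tendsto.mono_left nhdsWithin_le_nhds
  have h2 : Tendsto (fun x => g (b + x) (c + x) (d + x)) (𝓝[≠] 0) (𝓝 (g (b + 0) (c + 0) (d + 0))) :=
    (hg.continuousAt hmem).tendsto.mono_left nhdsWithin_le_nhds
  simpa using tendsto_nhds_unique (h1.congr' hev) h2

lemma continuousOn_awGenIntegral {a α : ℂ} {q : ℂ} (hq : ‖q‖ < 1) (ha : ‖a‖ < 1) (hα : ‖α‖ < 1)
    (b c d : ℂ) (m n : ℕ) :
    ContinuousOn (fun x => awGenIntegral a α (b + x) (c + x) (d + x) q m n)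
      {x | ‖b + x‖ < 1 ∧ ‖c + x‖ < 1 ∧ ‖d + x‖ < 1} := by
  rw [continuousOn_iff_continuous_domRestrict]
  exact continuous_awGenIntegral hq m n (by fun_prop) (by fun_prop) (by fun_prop) ha hα
    (fun x => x.2.1) (fun x => x.2.2.1) (fun x => x.2.2.2)

lemma awGenIntegral_of_lt {a α b c d : ℂ} {q : ℝ} (hq0 : 0 < q) (hq1 : q < 1) (ha : ‖a‖ < 1)
    (hα : ‖α‖ < 1) (hb : ‖b‖ < 1) (hc : ‖c‖ < 1) (hd : ‖d‖ < 1) (hα0 : α ≠ 0)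
    {m n : ℕ} (hmn : m < n) : awGenIntegral a α b c d q m n = 0 := by
  have hq : ‖(q : ℂ)‖ < 1 := by rwa [Complex.norm_real, Real.norm_of_nonneg hq0.le]
  refine eq_of_continuousOn_of_ne_zero (f := fun b c d => awGenIntegral a α b c d q m n)
    (g := fun _ _ _ => 0) hb hc hd (continuousOn_awGenIntegral hq ha hα b c d m n)
    continuousOn_const fun b c d hb hc hd hb0 hc0 hd0 => ?_
  rw [awGenIntegral_of_ne_zero hq0 hq1 ha hα hb hc hd hb0 hc0 hd0,
    integral_awSum_mul_awSum_of_lt hq0 hq1 hα hb hc hd hα0 hb0 hmn, mul_zero]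

lemma awGenIntegral_eq {a α b c d : ℂ} {q : ℝ} (hq0 : 0 < q) (hq1 : q < 1) (ha : ‖a‖ < 1)
    (hα : ‖α‖ < 1) (hb : ‖b‖ < 1) (hc : ‖c‖ < 1) (hd : ‖d‖ < 1) (hα0 : α ≠ 0) (n r : ℕ) :
    awGenIntegral a α b c d q (n + r) n = awGenMoment a α b c d q n r := by
  have hq : ‖(q : ℂ)‖ < 1 := by rwa [Complex.norm_real, Real.norm_of_nonneg hq0.le]
  have hqC : (q : ℂ) ≠ 0 := by exact_mod_cast hq0.ne'
  refine eq_of_continuousOn_of_ne_zero (f := fun b c d => awGenIntegral a α b c d q (n + r) n)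
    (g := fun b c d => awGenMoment a α b c d q n r) hb hc hd
    (continuousOn_awGenIntegral hq ha hα b c d _ n) ?_ fun b c d hb hc hd hb0 hc0 hd0 => ?_
  · rw [continuousOn_iff_continuous_domRestrict]
    exact continuous_awGenMoment hq n r (by fun_prop) (by fun_prop) (by fun_prop) ha hα
      (fun x => x.2.1) (fun x => x.2.2.1) (fun x => x.2.2.2)
  · have hcd := qPoch_ne_zero hq.le (norm_mul_lt_one hc hd) (n + r)
    rw [awGenIntegral_of_ne_zero hq0 hq1 ha hα hb hc hd hb0 hc0 hd0,
      integral_awSum_mul_awSum hq0 hq1 hα hb hc hd hα0 hb0 hc0 hd0, awGenMoment,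
      mul_assoc (2 * Real.pi : ℂ)]
    -- All powers of b cancel here, which is why the result extends to b = 0.
    have hscal : (b ^ (n + r) * (q : ℂ) ^ (n + r).choose 2)⁻¹ * ((α * b * q ^ n / q) ^ n *
        (α * b * q ^ n) ^ r * q ^ r.choose 2) = α ^ (n + r) * q ^ n.choose 2 := by
      have h1 := pow_choose_two_sq (q : ℂ) n
      rw [pow_choose_two_add, div_pow]
      simp only [mul_pow, ← pow_mul, ← h1]
      field_simp
      ring
    have h2 : qPoch (c * d) q n * qPoch (c * d * q ^ n) q r *
        (qPoch (c * d) q (n + r))⁻¹ = 1 := by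
      rw [qPoch_add] at hcd ⊢
      exact mul_inv_cancel₀ hcd
    generalize (α * b * q ^ n / q) ^ n = W at *
    generalize (α * b * q ^ n) ^ r = W' at *
    generalize α ^ (n + r) * (q : ℂ) ^ n.choose 2 = S' at *
    linear_combination (2 * Real.pi * qPoch (a * b * c * d * q ^ (n + r) / q) q n *
      qPoch (a / α) q r * qPochInf (α * b * c * d * q ^ (2 * n + r)) q /
      (qPoch q q n * qPoch (a * b) q (n + r) * qPoch q q r * qPochInf q q * qPochInf (c * d) q *
      qPochInf (α * b * q ^ n) q * qPochInf (α * c * q ^ n) q * qPochInf (α * d * q ^ n) q *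
      qPochInf (b * c * q ^ (n + r)) q * qPochInf (b * d * q ^ (n + r)) q)) *
      (qPoch (c * d) q n * qPoch (c * d * q ^ n) q r * (qPoch (c * d) q (n + r))⁻¹ * hscal +
        S' * h2)

/-! ### Translation of the series, polynomial, weight and variable x = cos θ. -/

lemma basicHyp_two_one (u v w q x : ℂ) : basicHyp [u, v] [w] q x =
    ∑' k : ℕ, qPoch u q k * qPoch v q k / (qPoch q q k * qPoch w q k) * x ^ k := by
  simp [basicHyp, qPochs]

lemma basicHyp_four_three (u₁ u₂ u₃ u₄ v₁ v₂ v₃ q x : ℂ) :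
    basicHyp [u₁, u₂, u₃, u₄] [v₁, v₂, v₃] q x =
    ∑' k : ℕ, qPoch u₁ q k * qPoch u₂ q k * qPoch u₃ q k * qPoch u₄ q k /
      (qPoch q q k * qPoch v₁ q k * qPoch v₂ q k * qPoch v₃ q k) * x ^ k := by
  simp [basicHyp, qPochs, mul_assoc]

lemma expITheta_eq_circleMap (x : ℝ) : expITheta x = circleMap 0 1 (Real.arccos x) := by
  simp [expITheta, circleMap, mul_comm]

/-- The ₄φ₃ terminates because of q^{-n}. Reversing (q^{-n};q)_j gives (q;q)_n / (q;q)_{n-j} up to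
powers, and the prefactors (ap;q)_n cancel the denominators (ap;q)_j to leave (apq^j;q)_{n-j}. -/
lemma askeyWilson_eq_awSum {a b c d q : ℂ} (hq : ‖q‖ < 1) (hq0 : q ≠ 0) (ha : ‖a‖ < 1)
    (hb : ‖b‖ < 1) (hc : ‖c‖ < 1) (hd : ‖d‖ < 1) (n : ℕ) (x : ℝ) :
    askeyWilson n x a b c d q =
      qPoch q q n / (a ^ n * q ^ n.choose 2) * awSum a b c d q n (expITheta x) := by
  set z := expITheta x
  have hfin : ∀ k, n < k → qPoch (q ^ (-(n : ℤ))) q k = 0 := fun k hk =>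
    prod_eq_zero (mem_range.mpr hk) (by simp [hq0])
  have hD : a * b * c * d * q ^ ((n : ℤ) - 1) = a * b * c * d * q ^ n / q := by
    rw [zpow_sub₀ hq0]; simp [mul_div_assoc]
  rw [askeyWilson, basicHyp_four_three, tsum_eq_sum (s := range n.succ)]
  swap
  · intro k hk
    rw [hfin k (by simpa using hk)]
    simp
  rw [← Nat.sum_antidiagonal_eq_sum_range_succ_mk (f := fun p : ℕ × ℕ =>
    qPoch (q ^ (-(n : ℤ))) q p.1 * qPoch (a * b * c * d * q ^ ((n : ℤ) - 1)) q p.1 *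
    qPoch (a * z) q p.1 * qPoch (a * z⁻¹) q p.1 / (qPoch q q p.1 * qPoch (a * b) q p.1 *
      qPoch (a * c) q p.1 * qPoch (a * d) q p.1) * q ^ p.1), awSum, mul_sum, mul_sum, hD]
  refine sum_congr rfl ?_
  rintro ⟨j, i⟩ hp
  have hji : j + i = n := HasAntidiagonal.mem_antidiagonal.mp hp
  dsimp only
  have hrev : qPoch (q ^ (-(n : ℤ))) q j =
      (-(q ^ (-(n : ℤ)))) ^ j * q ^ j.choose 2 * qPoch (q * q ^ i) q j := by
    apply qPoch_reverse hq0
    rw [zpow_neg, zpow_natCast, ← hji]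
    field_simp
    ring
  have hscal : (-(q ^ (-(n : ℤ)))) ^ j * q ^ j.choose 2 * q ^ j =
      (-1) ^ j * q ^ i.choose 2 * (q ^ n.choose 2)⁻¹ := by
    have h1 := pow_choose_two_sq q j
    rw [zpow_neg, zpow_natCast, neg_pow, inv_pow, ← pow_mul, ← hji, pow_choose_two_add, add_mul,
      pow_add, ← h1, mul_comm i j]
    field_simp
  have hqn : qPoch q q n = qPoch q q i * qPoch (q * q ^ i) q j := by
    rw [← qPoch_add, add_comm, hji]
  have hsplit : ∀ p : ℂ, ‖p‖ < 1 → qPoch (a * p) q n * (qPoch (a * p) q j)⁻¹ =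
      qPoch (a * p * q ^ j) q i := by
    intro p hp
    have h := qPoch_ne_zero hq.le (norm_mul_lt_one ha hp) j
    rw [← hji, qPoch_add, mul_comm, inv_mul_cancel_left₀ h]
  have hi := mul_inv_cancel₀ (qPoch_ne_zero hq.le hq i)
  simp only [qPochs, List.map_cons, List.map_nil, List.prod_cons, List.prod_nil, mul_one]
  rw [hrev, ← hsplit b hb, ← hsplit c hc, ← hsplit d hd, hqn]
  simp only [div_eq_mul_inv, mul_inv, zpow_neg a, zpow_natCast a]
  generalize (-(q ^ (-(n : ℤ)))) ^ j = W at *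
  linear_combination ((a ^ n)⁻¹ * qPoch (a * b) q n * (qPoch (a * b) q j)⁻¹ *
    qPoch (a * c) q n * (qPoch (a * c) q j)⁻¹ * qPoch (a * d) q n * (qPoch (a * d) q j)⁻¹ *
    qPoch (a * z) q j * qPoch (a * z⁻¹) q j * qPoch (a * b * c * d * q ^ n * q⁻¹) q j *
    (qPoch q q j)⁻¹ * qPoch (q * q ^ i) q j) * (hscal - (-1) ^ j * q ^ i.choose 2 *
      (q ^ n.choose 2)⁻¹ * hi)

/-- The squared modulus is the product with the conjugate. Conjugation sends z to 1/z on the unit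
circle and permutes the four parameters, so the result is the holomorphic kernel. -/
lemma askeyWilsonWeight_eq_awKernel {a b c d : ℂ} {q : ℝ} (hq : ‖(q : ℂ)‖ < 1)
    (h : RealOrConjPairs a b c d) (x : ℝ) :
    (askeyWilsonWeight x a b c d q : ℂ) = awKernel a b c d q (expITheta x) := by
  have hz : starRingEnd ℂ (expITheta x) = (expITheta x)⁻¹ := by
    rw [Complex.inv_def, expITheta_eq_circleMap, Complex.normSq_eq_norm_sq, norm_circleMap_one]
    simp
  rw [askeyWilsonWeight, Complex.ofReal_pow, ← Complex.mul_conj']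
  generalize expITheta x = z at *
  have hprod : ((({a, b, c, d} : Multiset ℂ).map (starRingEnd ℂ)).map
      fun p => qPochInf (p * z⁻¹) q).prod =
      (({a, b, c, d} : Multiset ℂ).map fun p => qPochInf (p * z⁻¹) q).prod := by
    rw [h]
  simp only [Multiset.insert_eq_cons, Multiset.map_cons, Multiset.map_singleton,
    Multiset.prod_cons, Multiset.prod_singleton] at hprod
  simp only [map_div₀, qPochsInf, List.map_cons, List.map_nil, List.prod_cons, List.prod_nil,
    mul_one, map_mul, conj_qPochInf _ hq, map_pow, hz, hprod, awKernel, div_mul_div_comm]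
  congr 1
  ring

lemma integral_div_sqrt_one_sub_sq {f : ℝ → ℂ} (hf : Continuous f) :
    IntervalIntegrable (fun x => f (Real.arccos x) * ((√(1 - x ^ 2))⁻¹ : ℝ)) volume (-1) 1 ∧
    ∫ x in (-1 : ℝ)..1, f (Real.arccos x) * ((√(1 - x ^ 2))⁻¹ : ℝ) =
      ∫ θ in (0 : ℝ)..Real.pi, f θ := by
  have hs : IntervalIntegrable (fun x => (((√(1 - x ^ 2))⁻¹ : ℝ) : ℂ)) volume (-1) 1 := by
    have := Polynomial.Chebyshev.intervalIntegrable_sqrt_one_sub_sq_inv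
    simp only [Real.sqrt_inv] at this
    exact ⟨this.1.ofReal, this.2.ofReal⟩
  have hint : IntervalIntegrable (fun x => f (Real.arccos x) * ((√(1 - x ^ 2))⁻¹ : ℝ))
      volume (-1) 1 :=
    hs.continuousOn_mul (hf.comp Real.continuous_arccos).continuousOn
  refine ⟨hint, ?_⟩
  -- The substitution x = cos θ for real functions, read off from the Chebyshev measure; real and
  -- imaginary parts are then treated separately.
  have key : ∀ g : ℝ → ℝ, ∫ x in (-1 : ℝ)..1, g (Real.arccos x) * (√(1 - x ^ 2))⁻¹ =
      ∫ θ in (0 : ℝ)..Real.pi, g θ := by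
    intro g
    have h1 := Polynomial.Chebyshev.integral_measureT (fun x => g (Real.arccos x))
    rw [Polynomial.Chebyshev.integral_measureT_eq_integral_cos] at h1
    simp only [Real.sqrt_inv] at h1
    rw [← h1]
    refine intervalIntegral.integral_congr fun θ hθ => ?_
    rw [Set.uIcc_of_le Real.pi_pos.le] at hθ
    simp only [Real.arccos_cos hθ.1 hθ.2]
  have hfi := hf.intervalIntegrable (μ := volume) 0 Real.pi
  apply Complex.ext
  · have h1 := Complex.reCLM.intervalIntegral_comp_comm hint
    have h2 := Complex.reCLM.intervalIntegral_comp_comm hfi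
    simp only [Complex.reCLM_apply] at h1 h2
    rw [← h1, ← h2, ← key fun θ => (f θ).re]
    simp
  · have h1 := Complex.imCLM.intervalIntegral_comp_comm hint
    have h2 := Complex.imCLM.intervalIntegral_comp_comm hfi
    simp only [Complex.imCLM_apply] at h1 h2
    rw [← h1, ← h2, ← key fun θ => (f θ).im]
    simp

/-! ### Bounds, termwise integration and the final evaluation. -/

lemma exists_norm_two_one_coeff_le {q w : ℂ} (hq : ‖q‖ < 1) (hw : ‖w‖ < 1) :
    ∃ C : ℝ, 0 ≤ C ∧ ∀ u v : ℂ, ‖u‖ ≤ 1 → ‖v‖ ≤ 1 → ∀ k,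
      ‖qPoch u q k * qPoch v q k / (qPoch q q k * qPoch w q k)‖ ≤ C := by
  obtain ⟨C₁, h1, hC₁⟩ := exists_norm_qPoch_le hq
  obtain ⟨C₂, h2, hC₂⟩ := exists_norm_inv_qPoch_le hq hq
  obtain ⟨C₃, h3, hC₃⟩ := exists_norm_inv_qPoch_le hq hw
  refine ⟨C₁ * C₁ * (C₂ * C₃), by positivity, fun u v hu hv k => ?_⟩
  rw [div_eq_mul_inv, mul_inv, norm_mul, norm_mul, norm_mul]
  gcongr
  exacts [hC₁ u hu k, hC₁ v hv k, hC₂ k, hC₃ k]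

/-- The coefficient has m + 1 terms, each bounded uniformly on the unit circle. The linear growth is
harmless against |t|^m. -/
lemma exists_norm_awGenCoeff_le {a b c d q : ℂ} (hq : ‖q‖ < 1) (ha : ‖a‖ < 1) (hb : ‖b‖ < 1)
    (hc : ‖c‖ < 1) (hd : ‖d‖ < 1) :
    ∃ C : ℝ, 0 ≤ C ∧ ∀ z : ℂ, ‖z‖ = 1 → ∀ m, ‖awGenCoeff a b c d q m z‖ ≤ C * (m + 1) := by
  obtain ⟨C₁, h1, hC₁⟩ := exists_norm_two_one_coeff_le hq (norm_mul_lt_one ha hb)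
  obtain ⟨C₂, h2, hC₂⟩ := exists_norm_two_one_coeff_le hq (norm_mul_lt_one hc hd)
  refine ⟨C₁ * C₂, by positivity, fun z hz m => ?_⟩
  have hzi : ‖z⁻¹‖ = 1 := by simp [hz]
  refine (norm_sum_le_of_le _ (f := fun _ => _) (n := fun _ => C₁ * C₂) fun p _ => ?_).trans_eq ?_
  · simp only [norm_mul _ (z ^ _), norm_mul _ (z⁻¹ ^ _), norm_mul (_ * z⁻¹ ^ _), norm_pow, hz, hzi,
      one_pow, mul_one]
    gcongr
    · exact hC₁ _ _ (norm_mul_lt_one_of_norm_eq ha hz).le (norm_mul_lt_one_of_norm_eq hb hz).le _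
    · exact hC₂ _ _ (norm_mul_lt_one_of_norm_eq hc hzi).le (norm_mul_lt_one_of_norm_eq hd hzi).le _
  · simp [mul_comm]

lemma summable_succ_mul_geometric {r : ℝ} (h0 : 0 ≤ r) (h1 : r < 1) (C : ℝ) :
    Summable fun m : ℕ => C * (m + 1) * r ^ m := by
  have h : ‖r‖ < 1 := by rwa [Real.norm_of_nonneg h0]
  have h2 := (summable_pow_mul_geometric_of_norm_lt_one 1 h).add
    (summable_geometric_of_norm_lt_one h)
  refine (h2.mul_left C).congr fun m => ?_
  ring

/-- The generating function of the Askey–Wilson polynomials. -/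
lemma basicHyp_mul_basicHyp_eq_tsum {a b c d q t z : ℂ} (hq : ‖q‖ < 1) (ha : ‖a‖ < 1)
    (hb : ‖b‖ < 1) (hc : ‖c‖ < 1) (hd : ‖d‖ < 1) (ht : ‖t‖ < 1) (hz : ‖z‖ = 1) :
    basicHyp [a * z, b * z] [a * b] q (t * z⁻¹) *
      basicHyp [c * z⁻¹, d * z⁻¹] [c * d] q (t * z) = ∑' m, t ^ m * awGenCoeff a b c d q m z := by
  have hzi : ‖z⁻¹‖ = 1 := by simp [hz]
  have hs : ∀ u v w x : ℂ, ‖u‖ ≤ 1 → ‖v‖ ≤ 1 → ‖w‖ < 1 → ‖x‖ < 1 → Summable fun k =>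
      ‖qPoch u q k * qPoch v q k / (qPoch q q k * qPoch w q k) * x ^ k‖ := by
    intro u v w x hu hv hw hx
    obtain ⟨C, _, hC⟩ := exists_norm_two_one_coeff_le hq hw
    refine Summable.of_nonneg_of_le (fun _ => norm_nonneg _) (fun k => ?_)
      ((summable_geometric_of_lt_one (norm_nonneg x) hx).mul_left C)
    rw [norm_mul, norm_pow]
    gcongr
    exact hC u v hu hv k
  rw [basicHyp_two_one, basicHyp_two_one, tsum_mul_tsum_eq_tsum_sum_antidiagonal_of_summable_norm]
  · refine tsum_congr fun m => ?_
    rw [awGenCoeff, mul_sum]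
    refine sum_congr rfl fun p hp => ?_
    rw [← HasAntidiagonal.mem_antidiagonal.mp hp, mul_pow, mul_pow, pow_add]
    ring
  · exact hs _ _ _ _ (norm_mul_lt_one_of_norm_eq ha hz).le (norm_mul_lt_one_of_norm_eq hb hz).le
      (norm_mul_lt_one ha hb) (norm_mul_lt_one_of_norm_eq ht hzi)
  · exact hs _ _ _ _ (norm_mul_lt_one_of_norm_eq hc hzi).le (norm_mul_lt_one_of_norm_eq hd hzi).le
      (norm_mul_lt_one hc hd) (norm_mul_lt_one_of_norm_eq ht hz)

/-- Opposite roots ±u contribute 1 - u²q^{2j}, so the choice of the square root disappears. -/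
lemma qPochs_sqrt (P q : ℂ) (n : ℕ) :
    qPochs [(P / q) ^ (1 / 2 : ℂ), -(P / q) ^ (1 / 2 : ℂ), P ^ (1 / 2 : ℂ), -P ^ (1 / 2 : ℂ)] q n =
      ∏ j ∈ range n, (1 - P / q * q ^ (2 * j)) * (1 - P * q ^ (2 * j)) := by
  have hsq : ∀ x : ℂ, (x ^ (1 / 2 : ℂ)) ^ 2 = x := fun x => by simp
  have h1 := hsq (P / q)
  have h2 := hsq P
  generalize (P / q) ^ (1 / 2 : ℂ) = u at *
  generalize P ^ (1 / 2 : ℂ) = v at *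
  simp only [qPochs, List.map_cons, List.map_nil, List.prod_cons, List.prod_nil, mul_one, qPoch,
    ← prod_mul_distrib]
  refine prod_congr rfl fun j _ => ?_
  rw [← h1, ← h2, mul_comm 2 j, pow_mul]
  ring

lemma qPochs_sqrt_eq_qPoch {P q : ℂ} (hq0 : q ≠ 0) (n : ℕ) :
    qPochs [(P / q) ^ (1 / 2 : ℂ), -(P / q) ^ (1 / 2 : ℂ), P ^ (1 / 2 : ℂ), -P ^ (1 / 2 : ℂ)] q n =
      qPoch (P / q) q (2 * n) := by
  rw [qPochs_sqrt]
  induction n with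
  | zero => simp [qPoch]
  | succ n ih =>
    rw [prod_range_succ, ih, show 2 * (n + 1) = 2 * n + 1 + 1 from rfl, qPoch_succ, qPoch_succ,
      pow_succ q (2 * n)]
    field_simp

/-- The series of the integrals of the generating coefficients. -/
lemma hasSum_awGenIntegral {a b c d α t q : ℂ} (hq : ‖q‖ < 1) (ha : ‖a‖ < 1) (hα : ‖α‖ < 1)
    (hb : ‖b‖ < 1) (hc : ‖c‖ < 1) (hd : ‖d‖ < 1) (ht : ‖t‖ < 1) (n : ℕ) :
    (Continuous fun θ : ℝ => (∑' m, t ^ m * awGenCoeff a b c d q m (circleMap 0 1 θ)) *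
      (awSum α b c d q n (circleMap 0 1 θ) * awKernel α b c d q (circleMap 0 1 θ))) ∧
    HasSum (fun m => t ^ m * awGenIntegral a α b c d q m n)
      (∫ θ in (0 : ℝ)..Real.pi, (∑' m, t ^ m * awGenCoeff a b c d q m (circleMap 0 1 θ)) *
        (awSum α b c d q n (circleMap 0 1 θ) * awKernel α b c d q (circleMap 0 1 θ))) := by
  have hz := continuous_circleMap 0 1
  have hw : Continuous fun θ : ℝ => awSum α b c d q n (circleMap 0 1 θ) *
      awKernel α b c d q (circleMap 0 1 θ) :=
    (continuous_awSum q n continuous_const continuous_const continuous_const continuous_const hz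
      norm_circleMap_one).mul (continuous_awKernel hq continuous_const continuous_const
      continuous_const continuous_const hz (fun _ => hα) (fun _ => hb) (fun _ => hc) (fun _ => hd)
      norm_circleMap_one)
  have hg : ∀ m, Continuous fun θ : ℝ => t ^ m * awGenCoeff a b c d q m (circleMap 0 1 θ) :=
    fun m => continuous_const.mul (continuous_awGenCoeff hq m continuous_const continuous_const
      continuous_const continuous_const hz (fun _ => ha) (fun _ => hb) (fun _ => hc) (fun _ => hd)
      norm_circleMap_one)
  obtain ⟨C, hC0, hC⟩ := exists_norm_awGenCoeff_le hq ha hb hc hd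
  have hsum := summable_succ_mul_geometric (norm_nonneg t) ht C
  have hbd : ∀ m (θ : ℝ), ‖t ^ m * awGenCoeff a b c d q m (circleMap 0 1 θ)‖ ≤
      C * (m + 1) * ‖t‖ ^ m := fun m θ => by
    rw [norm_mul, norm_pow, mul_comm]
    gcongr
    exact hC _ (norm_circleMap_one θ) m
  obtain ⟨M, hM⟩ := isCompact_uIcc (a := (0 : ℝ)) (b := Real.pi) |>.exists_bound_of_continuousOn
    hw.continuousOn
  refine ⟨(continuous_tsum hg hsum hbd).mul hw, ?_⟩
  have h := intervalIntegral.hasSum_integral_of_dominated_convergence (μ := volume)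
    (a := 0) (b := Real.pi) (F := fun m θ => t ^ m * awGenCoeff a b c d q m (circleMap 0 1 θ) *
      (awSum α b c d q n (circleMap 0 1 θ) * awKernel α b c d q (circleMap 0 1 θ)))
    (f := fun θ => (∑' m, t ^ m * awGenCoeff a b c d q m (circleMap 0 1 θ)) *
      (awSum α b c d q n (circleMap 0 1 θ) * awKernel α b c d q (circleMap 0 1 θ)))
    (fun m _ => C * (m + 1) * ‖t‖ ^ m * M)
    (fun m => ((hg m).mul hw).aestronglyMeasurable)
    (fun m => .of_forall fun θ hθ => by
      rw [norm_mul]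
      gcongr
      exacts [hbd m θ, hM θ (Set.uIoc_subset_uIcc hθ)])
    (.of_forall fun θ _ => hsum.mul_right M)
    intervalIntegrable_const
    (.of_forall fun θ _ => ((hsum.of_norm_bounded fun m => hbd m θ).hasSum).mul_right _)
  refine h.congr_fun fun m => ?_
  rw [awGenIntegral, ← intervalIntegral.integral_const_mul]
  refine intervalIntegral.integral_congr fun θ _ => ?_
  ring

lemma awGenMoment_eq {a b c d α t : ℂ} {q : ℝ} (hq0 : 0 < q) (hq1 : q < 1) (ha : ‖a‖ < 1)
    (hα : ‖α‖ < 1) (hb : ‖b‖ < 1) (hc : ‖c‖ < 1) (hd : ‖d‖ < 1) (hα0 : α ≠ 0)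
    (habcd : a * b * c * d ≠ (q : ℂ)) (n r : ℕ) :
    qPoch q q n / (α ^ n * q ^ n.choose 2) * (t ^ (n + r) * awGenMoment a α b c d q n r) =
      2 * (Real.pi : ℂ) * t ^ n * qPochInf (α * b * c * d * (q : ℂ) ^ (2 * n)) q *
        qPochs [(a * b * c * d / q) ^ (1 / 2 : ℂ), -(a * b * c * d / q) ^ (1 / 2 : ℂ),
          (a * b * c * d) ^ (1 / 2 : ℂ), -(a * b * c * d) ^ (1 / 2 : ℂ)] q n /
        (qPochsInf [(q : ℂ) ^ (n + 1), α * b * (q : ℂ) ^ n, α * c * (q : ℂ) ^ n,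
            α * d * (q : ℂ) ^ n, b * c * (q : ℂ) ^ n, b * d * (q : ℂ) ^ n,
            c * d * (q : ℂ) ^ n] q *
          qPochs [(q : ℂ), a * b, c * d, a * b * c * d / q] q n) *
      (qPoch (a / α) q r * qPoch (b * c * (q : ℂ) ^ n) q r * qPoch (b * d * (q : ℂ) ^ n) q r *
          qPoch (a * b * c * d * (q : ℂ) ^ (2 * (n : ℤ) - 1)) q r /
        (qPoch q q r * qPoch (a * b * (q : ℂ) ^ n) q r *
          qPoch (a * b * c * d * (q : ℂ) ^ ((n : ℤ) - 1)) q r *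
          qPoch (α * b * c * d * (q : ℂ) ^ (2 * n)) q r) * (α * t) ^ r) := by
  have hq : ‖(q : ℂ)‖ < 1 := by rwa [Complex.norm_real, Real.norm_of_nonneg hq0.le]
  have hqC : (q : ℂ) ≠ 0 := by exact_mod_cast hq0.ne'
  set P := a * b * c * d with hP
  have hP1 : ‖P‖ < 1 := norm_mul_lt_one (norm_mul_lt_one (norm_mul_lt_one ha hb) hc) hd
  -- The factor of index 0 is 1 - abcd/q, nonzero by `habcd`; the later ones are 1 - Pq^j with |P| <
  -- 1.
  have hPne : ∀ k, qPoch (P / q) q k ≠ 0 := by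
    intro k
    refine prod_ne_zero_iff.mpr fun j _ => ?_
    rcases j with _ | j
    · rw [pow_zero, mul_one, sub_ne_zero, ne_comm, ne_eq, div_eq_one_iff_eq hqC]
      exact habcd
    · have : P / q * (q : ℂ) ^ (j + 1) = P * q ^ j := by rw [pow_succ]; field_simp
      rw [this]
      exact one_sub_mul_pow_ne_zero hq.le hP1 j
  have z1 : P * (q : ℂ) ^ (2 * (n : ℤ) - 1) = P / q * q ^ (2 * n) := by
    rw [zpow_sub₀ hqC, zpow_mul]
    simp only [zpow_ofNat, zpow_natCast]
    rw [pow_mul]; ring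
  have z2 : P * (q : ℂ) ^ ((n : ℤ) - 1) = P / q * q ^ n := by
    rw [zpow_sub₀ hqC]
    simp only [zpow_natCast, zpow_one]
    ring
  have z3 : P * (q : ℂ) ^ (n + r) / q = P / q * q ^ n * q ^ r := by
    rw [pow_add]; ring
  -- Both sides split (P/q;q)_{2n+r}. This trades the trailing block of length n in the moment for
  -- the ₄φ₃ factors.
  have hPP : qPoch (P / q) q (2 * n) * qPoch (P / q * q ^ (2 * n)) q r =
      qPoch (P / q) q n * (qPoch (P / q * q ^ n) q r * qPoch (P / q * q ^ n * q ^ r) q n) := by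
    rw [← qPoch_add, ← qPoch_add, ← qPoch_add]
    congr 1
    ring
  have hPr : qPoch (P / q) q n ≠ 0 ∧ qPoch (P / q * q ^ n) q r ≠ 0 := by
    have h := hPne (n + r)
    rw [qPoch_add] at h
    exact ⟨left_ne_zero_of_mul h, right_ne_zero_of_mul h⟩
  have hPfin : qPoch (P / q) q (2 * n) * qPoch (P / q * q ^ (2 * n)) q r *
      (qPoch (P / q) q n)⁻¹ * (qPoch (P / q * q ^ n) q r)⁻¹ =
      qPoch (P / q * q ^ n * q ^ r) q n := by
    rw [hPP]
    have h1 := hPr.1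
    have h2 := hPr.2
    generalize qPoch (P / q) q n = x at *
    generalize qPoch (P / q * q ^ n) q r = y at *
    field_simp
  have hD : ‖α * b * c * d‖ < 1 := norm_mul_lt_one (norm_mul_lt_one (norm_mul_lt_one hα hb) hc) hd
  have hDfin : qPochInf (α * b * c * d * q ^ (2 * n + r)) q =
      qPochInf (α * b * c * d * q ^ (2 * n)) q * (qPoch (α * b * c * d * q ^ (2 * n)) q r)⁻¹ := by
    have h := qPoch_ne_zero hq.le (norm_mul_pow_lt_one hD hq (2 * n)) r
    rw [qPochInf_eq_qPoch_mul (α * b * c * d * q ^ (2 * n)) hq r, mul_comm (qPoch _ _ _),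
      mul_inv_cancel_right₀ h, pow_add, mul_assoc (α * b * c * d)]
  have hsh : ∀ x : ℂ, ‖x‖ < 1 → (qPochInf (x * q ^ (n + r)) q)⁻¹ =
      qPoch (x * q ^ n) q r * (qPochInf (x * q ^ n) q)⁻¹ := by
    intro x hx
    rw [pow_add, ← mul_assoc, inv_qPochInf_mul_pow hq (norm_mul_pow_lt_one hx hq n)]
  have hqinf : (qPochInf ((q : ℂ) ^ (n + 1)) q)⁻¹ = qPoch q q n * (qPochInf q q)⁻¹ := by
    rw [pow_succ', inv_qPochInf_mul_pow hq hq]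
  have hcd := inv_qPochInf_mul_pow hq (norm_mul_lt_one hc hd) n
  have hcdn := qPoch_ne_zero hq.le (norm_mul_lt_one hc hd) n
  rw [z1, z2, qPochs_sqrt_eq_qPoch hqC, awGenMoment, ← hP, z3, ← hPfin, hDfin, qPoch_add (a * b)]
  simp only [qPochs, qPochsInf, List.map_cons, List.map_nil, List.prod_cons, List.prod_nil, mul_one]
  simp only [div_eq_mul_inv, mul_inv, hsh _ (norm_mul_lt_one hb hc), hsh _ (norm_mul_lt_one hb hd),
    hqinf, hcd]
  have s1 : (α ^ n)⁻¹ * α ^ (n + r) = α ^ r := by rw [pow_add]; field_simp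
  have s2 : ((q : ℂ) ^ n.choose 2)⁻¹ * q ^ n.choose 2 = 1 := inv_mul_cancel₀ (by positivity)
  have s4 := mul_inv_cancel₀ hcdn
  rw [pow_add t, mul_pow α t]
  generalize α ^ (n + r) = u at *
  generalize (q : ℂ) ^ n.choose 2 = v at *
  linear_combination (2 * Real.pi * t ^ n * t ^ r * (qPoch (P * (q : ℂ)⁻¹) q (2 * n) *
    qPoch (P * (q : ℂ)⁻¹ * q ^ (2 * n)) q r * (qPoch (P * (q : ℂ)⁻¹) q n)⁻¹ *
    (qPoch (P * (q : ℂ)⁻¹ * q ^ n) q r)⁻¹) * qPoch (a * α⁻¹) q r *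
    (qPochInf (α * b * c * d * q ^ (2 * n)) q * (qPoch (α * b * c * d * q ^ (2 * n)) q r)⁻¹) *
    ((qPoch (a * b) q n)⁻¹ * (qPoch (a * b * q ^ n) q r)⁻¹ * (qPoch q q r)⁻¹ *
    (qPochInf q q)⁻¹ * (qPochInf (c * d) q)⁻¹ * (qPochInf (α * b * q ^ n) q)⁻¹ *
    (qPochInf (α * c * q ^ n) q)⁻¹ * (qPochInf (α * d * q ^ n) q)⁻¹ *
    (qPoch (b * c * q ^ n) q r * (qPochInf (b * c * q ^ n) q)⁻¹) *
    (qPoch (b * d * q ^ n) q r * (qPochInf (b * d * q ^ n) q)⁻¹)) *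
    (qPoch q q n * (qPoch q q n)⁻¹)) * (v⁻¹ * v * s1 + α ^ r * s2 - α ^ r * s4)

theorem mainTheorem12 (n : ℕ) (α a b c d t : ℂ) (q : ℝ)
    (hq0 : 0 < q) (hq1 : q < 1)
    (hpairs : RealOrConjPairs α b c d)
    (hα : ‖α‖ < 1) (ha : ‖a‖ < 1) (hb : ‖b‖ < 1) (hc : ‖c‖ < 1) (hd : ‖d‖ < 1)
    (hα0 : α ≠ 0) (habcd : a * b * c * d ≠ (q : ℂ))
    (ht : ‖t‖ < (1 - q) ^ 3) :
    IntervalIntegrable (askeyWilsonIntegrand n α a b c d t q) MeasureTheory.volume (-1) 1 ∧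
    ∫ x in (-1 : ℝ)..1, askeyWilsonIntegrand n α a b c d t q x =
      2 * (Real.pi : ℂ) * t ^ n * qPochInf (α * b * c * d * (q : ℂ) ^ (2 * n)) q *
        qPochs [(a * b * c * d / q) ^ (1 / 2 : ℂ), -(a * b * c * d / q) ^ (1 / 2 : ℂ),
          (a * b * c * d) ^ (1 / 2 : ℂ), -(a * b * c * d) ^ (1 / 2 : ℂ)] q n /
        (qPochsInf [(q : ℂ) ^ (n + 1), α * b * (q : ℂ) ^ n, α * c * (q : ℂ) ^ n,
            α * d * (q : ℂ) ^ n, b * c * (q : ℂ) ^ n, b * d * (q : ℂ) ^ n,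
            c * d * (q : ℂ) ^ n] q *
          qPochs [(q : ℂ), a * b, c * d, a * b * c * d / q] q n) *
        basicHyp
          [a / α, b * c * (q : ℂ) ^ n, b * d * (q : ℂ) ^ n,
            a * b * c * d * (q : ℂ) ^ (2 * (n : ℤ) - 1)]
          [a * b * (q : ℂ) ^ n, a * b * c * d * (q : ℂ) ^ ((n : ℤ) - 1),
            α * b * c * d * (q : ℂ) ^ (2 * n)]
          q (α * t) := by
  have hq : ‖(q : ℂ)‖ < 1 := by rwa [Complex.norm_real, Real.norm_of_nonneg hq0.le]
  have hqC : (q : ℂ) ≠ 0 := by exact_mod_cast hq0.ne'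
  have ht1 : ‖t‖ < 1 := ht.trans_le (pow_le_one₀ (by linarith) (by linarith))
  obtain ⟨hcont, hsum⟩ := hasSum_awGenIntegral hq ha hα hb hc hd ht1 n
  set κ := qPoch q q n / (α ^ n * (q : ℂ) ^ n.choose 2) with hκ
  set f : ℝ → ℂ := fun θ => κ * ((∑' m, t ^ m * awGenCoeff a b c d q m (circleMap 0 1 θ)) *
      (awSum α b c d q n (circleMap 0 1 θ) * awKernel α b c d q (circleMap 0 1 θ))) with hf
  have hfun : askeyWilsonIntegrand n α a b c d t q =
      fun x => f (Real.arccos x) * ((√(1 - x ^ 2))⁻¹ : ℝ) := by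
    ext x
    have hz : ‖expITheta x‖ = 1 := by rw [expITheta_eq_circleMap, norm_circleMap_one]
    rw [askeyWilsonIntegrand, basicHyp_mul_basicHyp_eq_tsum hq ha hb hc hd ht1 hz,
      askeyWilson_eq_awSum hq hqC hα hb hc hd, div_eq_mul_inv (askeyWilsonWeight x α b c d q),
      Complex.ofReal_mul, askeyWilsonWeight_eq_awKernel hq hpairs, hf, ← hκ]
    simp only [expITheta_eq_circleMap]
    ring
  obtain ⟨hint, hval⟩ := integral_div_sqrt_one_sub_sq (f := f) (continuous_const.mul hcont)
  rw [hfun]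
  refine ⟨hint, ?_⟩
  have hshift : HasSum (fun r => κ * (t ^ (n + r) * awGenMoment a α b c d q n r))
      (∫ θ in (0 : ℝ)..Real.pi, f θ) := by
    rw [hf, intervalIntegral.integral_const_mul]
    refine HasSum.mul_left κ ?_
    -- Degrees m < n drop out by orthogonality, so the series starts at t^n.
    have h0 : ∑ m ∈ range n, t ^ m * awGenIntegral a α b c d q m n = 0 :=
      sum_eq_zero fun m hm => by
        rw [awGenIntegral_of_lt hq0 hq1 ha hα hb hc hd hα0 (mem_range.mp hm), mul_zero]
    have h1 := (hasSum_nat_add_iff' n).mpr hsum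
    rw [h0, sub_zero] at h1
    refine h1.congr_fun fun r => ?_
    rw [add_comm r n, awGenIntegral_eq hq0 hq1 ha hα hb hc hd hα0]
  rw [hval, ← hshift.tsum_eq, basicHyp_four_three, ← tsum_mul_left]
  exact tsum_congr fun r => awGenMoment_eq hq0 hq1 ha hα hb hc hd hα0 habcd n r
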